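/- Let $\Bbbk$ be an algebraically closed field of arbitrary characteristic, let $H$ be an affine (that is, finitely generated) Hopf algebra over $\Bbbk$, and let $C\subseteq H$ be a central Hopf subalgebra such that $H$ is a finitely generated $C$-module. Let $\mathfrak m_{\overline\varepsilon}=\ker(\varepsilon|_C)$ be the augmentation ideal of $C$. For an algebra $A$ write $A\text{-mod}$ for the category of finite-dimensional left $A$-modules, $\mathrm{Irr}(A)$ for the set of isomorphism classes of simple $A$-modules and $\mathrm{Gr}(A)$ for the Grothendieck group of $A\text{-mod}$. For every ideal $\mathfrak m$ of $C$, the comultiplication of $H$ makes $H/\mathfrak m_{\overline\varepsilon}H$ a Hopf algebra and $H/\mathfrak mH$ a left comodule algebra over it; hence $V\otimes W$ is an $H/\mathfrak mH$-module for $V\in H/\mathfrak m_{\overline\varepsilon}H\text{-mod}$ and $W\in H/\mathfrak mH\text{-mod}$, which defines a monoidal structure on $H/\mathfrak m_{\overline\varepsilon}H\text{-mod}$ and a left action of it on $H/\mathfrak mH\text{-mod}$. Then for every maximal ideal $\mathfrak m$ of $C$: (1) $H/\mathfrak m_{\overline\varepsilon}H\text{-mod}$ is a finite tensor category, and with the above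 action $H/\mathfrak mH\text{-mod}$ is a finite, indecomposable, exact left module category over it. Here a $\Bbbk$-linear abelian category is finite if its Hom-spaces are finite-dimensional, all objects have finite length, there are enough projectives, and there are finitely many isomorphism classes of simple objects; a finite tensor category is a finite $\Bbbk$-linear abelian category with a rigid monoidal structure, with $\Bbbk$-bilinear tensor product and simple unit object; a left module category over a finite tensor category $\mathcal C$ is a $\Bbbk$-linear abelian category with a $\Bbbk$-bilinear action of $\mathcal C$ that is exact in the first variable; it is exact if $P\otimes M$ is projective for every projective $P\in\mathcal C$ and every object $M$, and indecomposable if it is not equivalent, as a module category, to a direct sum of two nonzero $\mathcal C$-module categories. (2) $\mathrm{Gr}(H/\mathfrak m_{\overline\varepsilon}H)$, with the product $[V][V']=[V\otimes V']$, is a unital $\mathbb Z_+$-ring with $\mathbb Z_+$-basis $\mathrm{Irr}(H/\mathfrak m_{\overline\varepsilon}H)$, and $\mathrm{Gr}(H/\mathfrak mH)$, with the action $[V][W]=[V\otimes W]$ and the basis $\mathrm{Irr}(H/\mathfrak mH)$, is an irreducible $\mathbb Z_+$-module over it: the sets of classes of simple modules are $\mathbb Z$-bases, the structure constants of the product and of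 the action are nonnegative, the identity is a basis element, $\mathrm{Gr}(H/\mathfrak mH)\neq 0$, and the only subsets of $\mathrm{Irr}(H/\mathfrak mH)$ whose $\mathbb Z$-span is stable under $\mathrm{Gr}(H/\mathfrak m_{\overline\varepsilon}H)$ are the empty set and the whole set. -/

import Mathlib

open CategoryTheory CategoryTheory.MonoidalCategory CategoryTheory.Limits TensorProduct

/-! ### Finite tensor categories and their module categories -/

universe w v₀ u₀ v₁ u₁ v₂ u₂

section Categorical

/-- Isomorphism of simple objects. -/
def simpleSetoid (𝓜 : Type u₁) [Category.{v₁} 𝓜] [HasZeroMorphisms 𝓜] :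
    Setoid {X : 𝓜 // Simple X} where
  r X Y := Nonempty (X.1 ≅ Y.1)
  iseqv :=
    { refl := fun X => ⟨Iso.refl X.1⟩
      symm := fun ⟨e⟩ => ⟨e.symm⟩
      trans := fun ⟨e⟩ ⟨f⟩ => ⟨e ≪≫ f⟩ }

/-- `Irr 𝓜`: the isomorphism classes of simple objects of `𝓜`. -/
def Irr (𝓜 : Type u₁) [Category.{v₁} 𝓜] [HasZeroMorphisms 𝓜] : Type u₁ :=
  Quotient (simpleSetoid 𝓜)

/-- A finite `k`-linear abelian category: abelian, with finite-dimensional Hom-spaces, all objects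
of finite length, enough projectives, and finitely many simple objects up to isomorphism.
(Being abelian is a property of the given preadditive structure, spelled out by the fields of
Mathlib's class `Abelian`.) -/
structure IsFiniteAbelian (k : Type w) [Field k] (𝓜 : Type u₁) [Category.{v₁} 𝓜]
    [Preadditive 𝓜] [Linear k 𝓜] : Prop where
  hasFiniteProducts : HasFiniteProducts 𝓜
  hasKernels : HasKernels 𝓜
  hasCokernels : HasCokernels 𝓜
  normalMono : IsNormalMonoCategory 𝓜
  normalEpi : IsNormalEpiCategory 𝓜
  finite_hom : ∀ X Y : 𝓜, Module.Finite k (X ⟶ Y)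
  -- there is a bound on the length of chains of subobjects
  finite_length : ∀ X : 𝓜, FiniteDimensionalOrder (Subobject X)
  enoughProjectives : EnoughProjectives 𝓜
  finite_irr : Finite (Irr 𝓜)

/-- A finite tensor category over `k`: a finite `k`-linear abelian category with a rigid monoidal
structure whose tensor product is `k`-bilinear on morphisms and whose unit object is simple. -/
structure IsFiniteTensorCategory (k : Type w) [Field k] (𝓒 : Type u₀) [Category.{v₀} 𝓒]
    [Preadditive 𝓒] [Linear k 𝓒] [MonoidalCategory 𝓒] : Prop where
  finiteAbelian : IsFiniteAbelian k 𝓒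
  monoidalPreadditive : MonoidalPreadditive 𝓒
  monoidalLinear : MonoidalLinear k 𝓒
  rigid : Nonempty (RigidCategory 𝓒)
  simple_unit : Simple (𝟙_ 𝓒)

open MonoidalLeftAction

/-- A `k`-linear category `𝓜` with a left action of `𝓒` (including the associativity and unit
constraints, which are part of `MonoidalLeftAction`) is a `𝓒`-module category if the action is
`k`-bilinear on morphisms and exact in the first variable. -/
structure IsModuleCategory (k : Type w) [Field k]
    (𝓒 : Type u₀) [Category.{v₀} 𝓒] [Preadditive 𝓒] [Linear k 𝓒] [MonoidalCategory 𝓒]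
    (𝓜 : Type u₁) [Category.{v₁} 𝓜] [Preadditive 𝓜] [Linear k 𝓜] [MonoidalLeftAction 𝓒 𝓜] :
    Prop where
  add_left : ∀ {X Y : 𝓒} (f g : X ⟶ Y) (M : 𝓜), (f + g) ⊵ₗ M = f ⊵ₗ M + g ⊵ₗ M
  smul_left : ∀ (r : k) {X Y : 𝓒} (f : X ⟶ Y) (M : 𝓜), (r • f) ⊵ₗ M = r • (f ⊵ₗ M)
  add_right : ∀ (X : 𝓒) {M N : 𝓜} (f g : M ⟶ N), X ⊴ₗ (f + g) = X ⊴ₗ f + X ⊴ₗ g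
  smul_right : ∀ (r : k) (X : 𝓒) {M N : 𝓜} (f : M ⟶ N), X ⊴ₗ (r • f) = r • (X ⊴ₗ f)
  preservesFiniteLimits : ∀ M : 𝓜, PreservesFiniteLimits (actionRight 𝓒 M)
  preservesFiniteColimits : ∀ M : 𝓜, PreservesFiniteColimits (actionRight 𝓒 M)

/-- A module category is exact if `P ⊙ₗ M` is projective for every projective object `P` of `𝓒`
and every object `M`. -/
def IsExactModuleCategory (𝓒 : Type u₀) [Category.{v₀} 𝓒] [MonoidalCategory 𝓒]
    (𝓜 : Type u₁) [Category.{v₁} 𝓜] [MonoidalLeftAction 𝓒 𝓜] : Prop :=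
  ∀ (P : 𝓒) (M : 𝓜), Projective P → Projective (P ⊙ₗ M)

/-- The direct sum of two module categories: the product category with componentwise action. -/
@[reducible]
def prodAction (𝓒 : Type u₀) [Category.{v₀} 𝓒] [MonoidalCategory 𝓒]
    (𝓜₁ : Type u₁) [Category.{v₁} 𝓜₁] [MonoidalLeftAction 𝓒 𝓜₁]
    (𝓜₂ : Type u₂) [Category.{v₂} 𝓜₂] [MonoidalLeftAction 𝓒 𝓜₂] :
    MonoidalLeftAction 𝓒 (𝓜₁ × 𝓜₂) where
  actionObj X M := (X ⊙ₗ M.1, X ⊙ₗ M.2)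
  actionHomLeft f M := (f ⊵ₗ M.1, f ⊵ₗ M.2)
  actionHomRight X _ _ f := (X ⊴ₗ f.1, X ⊴ₗ f.2)
  actionHom f g := (f ⊙ₗₘ g.1, f ⊙ₗₘ g.2)
  actionAssocIso X Y M := Iso.prod (αₗ X Y M.1) (αₗ X Y M.2)
  actionUnitIso M := Iso.prod (λₗ M.1) (λₗ M.2)
  actionHom_def f g := Prod.ext (actionHom_def f g.1) (actionHom_def f g.2)
  actionHomRight_id X M := Prod.ext (actionHomRight_id X M.1) (actionHomRight_id X M.2)
  id_actionHomLeft X M := Prod.ext (id_actionHomLeft X M.1) (id_actionHomLeft X M.2)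
  actionHom_comp f f' g g' :=
    Prod.ext (actionHom_comp f f' g.1 g'.1) (actionHom_comp f f' g.2 g'.2)
  actionAssocIso_hom_naturality f g h :=
    Prod.ext (actionAssocIso_hom_naturality f g h.1) (actionAssocIso_hom_naturality f g h.2)
  actionUnitIso_hom_naturality f :=
    Prod.ext (actionUnitIso_hom_naturality f.1) (actionUnitIso_hom_naturality f.2)
  whiskerLeft_actionHomLeft X _ _ f M :=
    Prod.ext (whiskerLeft_actionHomLeft X f M.1) (whiskerLeft_actionHomLeft X f M.2)
  whiskerRight_actionHomLeft X f M :=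
    Prod.ext (whiskerRight_actionHomLeft X f M.1) (whiskerRight_actionHomLeft X f M.2)
  associator_actionHom X Y Z M :=
    Prod.ext (associator_actionHom X Y Z M.1) (associator_actionHom X Y Z M.2)
  leftUnitor_actionHom X M :=
    Prod.ext (leftUnitor_actionHom X M.1) (leftUnitor_actionHom X M.2)
  rightUnitor_actionHom X M :=
    Prod.ext (rightUnitor_actionHom X M.1) (rightUnitor_actionHom X M.2)

/-- A module category `𝓜` over `𝓒` is indecomposable if it is not equivalent, as a module category,
to a direct sum of two nonzero `𝓒`-module categories. An equivalence of module categories is an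
equivalence of categories that commutes with the action of `𝓒` up to coherent natural isomorphisms;
it is automatically `k`-linear, since scalars act through the endomorphisms of `𝟙_ 𝓒`.
The summands may live in any universes. -/
def IsIndecomposableModuleCategory (k : Type w) [Field k]
    (𝓒 : Type u₀) [Category.{v₀} 𝓒] [Preadditive 𝓒] [Linear k 𝓒] [MonoidalCategory 𝓒]
    (𝓜 : Type u₁) [Category.{v₁} 𝓜] [MonoidalLeftAction 𝓒 𝓜] : Prop :=
  ∀ (𝓜₁ 𝓜₂ : Type u₂) [Category.{v₂} 𝓜₁] [Category.{v₂} 𝓜₂] [Abelian 𝓜₁] [Abelian 𝓜₂]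
    [Linear k 𝓜₁] [Linear k 𝓜₂] [MonoidalLeftAction 𝓒 𝓜₁] [MonoidalLeftAction 𝓒 𝓜₂],
    IsModuleCategory k 𝓒 𝓜₁ → IsModuleCategory k 𝓒 𝓜₂ →
    (∃ X : 𝓜₁, ¬ IsZero X) → (∃ Y : 𝓜₂, ¬ IsZero Y) →
    letI := prodAction 𝓒 𝓜₁ 𝓜₂
    ∀ F : 𝓜 ≌ 𝓜₁ × 𝓜₂, IsEmpty (F.functor.LeftLinear 𝓒)

end Categorical

/-! ### `ℤ₊`-rings and `ℤ₊`-modules -/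

section ZPlus

/-- A `ℤ`-basis `b` of a ring `R` makes `R` a unital `ℤ₊`-ring if the structure constants are
nonnegative and the identity is an element of the basis. -/
structure IsUnitalZPlusRing {R I : Type*} [Ring R] (b : Module.Basis I ℤ R) : Prop where
  mul_nonneg : ∀ i j l, 0 ≤ b.repr (b i * b j) l
  one_mem : 1 ∈ Set.range b

/-- An `R`-module with `ℤ`-basis `m` is a `ℤ₊`-module over the `ℤ₊`-ring `(R, b)` if the structure
constants of the action are nonnegative. -/
def IsZPlusModule {R I N L : Type*} [Ring R] [AddCommGroup N] [Module R N]
    (b : Module.Basis I ℤ R) (m : Module.Basis L ℤ N) : Prop :=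
  ∀ i l l', 0 ≤ m.repr (b i • m l) l'

/-- A `ℤ₊`-module `(N, m)` over `(R, b)` is irreducible if it is nonzero and its only
`ℤ₊`-submodules, i.e. the `R`-submodules spanned over `ℤ` by a subset of the basis `m`, are
zero and the whole module. -/
structure IsIrreducibleZPlusModule {R I N L : Type*} [Ring R] [AddCommGroup N] [Module R N]
    (b : Module.Basis I ℤ R) (m : Module.Basis L ℤ N) : Prop where
  isZPlusModule : IsZPlusModule b m
  nonempty : Nonempty L
  eq_empty_or_univ : ∀ J : Set L,
    (∀ (r : R), ∀ x ∈ Submodule.span ℤ (m '' J), r • x ∈ Submodule.span ℤ (m '' J)) →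
      J = ∅ ∨ J = Set.univ

end ZPlus

/-! ### Finite-dimensional modules over an algebra -/

universe u

/-- A finite-dimensional (left) module over the `k`-algebra `A`, given by a finite-dimensional
vector space with an algebra homomorphism `ρ` to its endomorphism algebra. -/
structure FinMod (k A : Type u) [Field k] [Ring A] [Algebra k A] : Type (u + 1) where
  carrier : Type u
  [addCommGroup : AddCommGroup carrier]
  [module : Module k carrier]
  [finite : Module.Finite k carrier]
  ρ : A →ₐ[k] Module.End k carrier

namespace FinMod

section Basic

variable {k A : Type u} [Field k] [Ring A] [Algebra k A]

attribute [instance] addCommGroup module finite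

instance : CoeSort (FinMod k A) (Type u) := ⟨carrier⟩

/-- The space of `A`-linear maps. -/
def hom (V W : FinMod k A) : Submodule k (V →ₗ[k] W) where
  carrier := {f | ∀ (a : A) (v : V), f (V.ρ a v) = W.ρ a (f v)}
  add_mem' hf hg a v := by simp [hf a v, hg a v]
  zero_mem' a v := by simp
  smul_mem' r f hf a v := by simp [hf a v]

instance : Category (FinMod k A) where
  Hom V W := hom V W
  id V := ⟨LinearMap.id, fun _ _ => rfl⟩
  comp f g := ⟨g.1 ∘ₗ f.1, fun a v => by simp [f.2 a v, g.2 a]⟩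

/-- The underlying linear map of a morphism. -/
def lin {V W : FinMod k A} (f : V ⟶ W) : V →ₗ[k] W := f.1

/-- A morphism from an `A`-linear map. -/
def ofLin {V W : FinMod k A} (f : V →ₗ[k] W) (hf : ∀ a v, f (V.ρ a v) = W.ρ a (f v)) : V ⟶ W :=
  ⟨f, hf⟩

theorem hom_ext {V W : FinMod k A} {f g : V ⟶ W} (h : lin f = lin g) : f = g := Subtype.ext h

theorem lin_comm {V W : FinMod k A} (f : V ⟶ W) (a : A) (v : V) :
    lin f (V.ρ a v) = W.ρ a (lin f v) := f.2 a v

@[simp] theorem lin_ofLin {V W : FinMod k A} (f : V →ₗ[k] W) (hf) :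
    lin (ofLin f hf : V ⟶ W) = f := rfl

@[simp] theorem lin_id (V : FinMod k A) : lin (𝟙 V) = LinearMap.id := rfl

@[simp] theorem lin_comp {V W X : FinMod k A} (f : V ⟶ W) (g : W ⟶ X) :
    lin (f ≫ g) = lin g ∘ₗ lin f := rfl

instance : Preadditive (FinMod k A) where
  homGroup V W := inferInstanceAs (AddCommGroup (hom V W))
  add_comp _ _ _ f f' g := hom_ext (LinearMap.comp_add (lin f) (lin f') (lin g))
  comp_add _ _ _ f g g' := hom_ext (LinearMap.add_comp (lin f) (lin g') (lin g))

instance : Linear k (FinMod k A) where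
  homModule V W := inferInstanceAs (Module k (hom V W))
  smul_comp _ _ _ r f g := hom_ext (LinearMap.comp_smul (lin g) r (lin f))
  comp_smul _ _ _ f r g := hom_ext (LinearMap.smul_comp r (lin g) (lin f))

/-- An isomorphism from an `A`-linear equivalence. -/
def isoOfLin {V W : FinMod k A} (e : V ≃ₗ[k] W) (he : ∀ a v, e (V.ρ a v) = W.ρ a (e v)) :
    V ≅ W where
  hom := ofLin e.toLinearMap he
  inv := ofLin e.symm.toLinearMap fun a w => by
    apply e.injective
    simp [he]
  hom_inv_id := hom_ext (by ext; simp)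
  inv_hom_id := hom_ext (by ext; simp)

/-- The zero module. -/
def zero : FinMod k A where
  carrier := PUnit
  ρ := { toFun := fun _ => 1
         map_one' := rfl
         map_mul' := fun _ _ => rfl
         map_zero' := Subsingleton.elim _ _
         map_add' := fun _ _ => Subsingleton.elim _ _
         commutes' := fun _ => Subsingleton.elim _ _ }

end Basic

end FinMod

/-! ### Comodule algebras and the tensor product of modules -/

/-- A left comodule algebra over the bialgebra `A`: an algebra `D` with a coassociative counital
algebra homomorphism `D → A ⊗ D`. -/
class LeftComoduleAlgebra (k A D : Type u) [Field k] [Ring A] [Bialgebra k A] [Ring D]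
    [Algebra k D] where
  /-- the coaction -/
  coact : D →ₐ[k] A ⊗[k] D
  coassoc : ∀ d, TensorProduct.assoc k A A D
      (TensorProduct.map (Coalgebra.comul (R := k) (A := A)) LinearMap.id (coact d)) =
    TensorProduct.map LinearMap.id coact.toLinearMap (coact d)
  counit_coact : ∀ d, TensorProduct.map (Coalgebra.counit (R := k) (A := A)) LinearMap.id (coact d)
    = (1 : k) ⊗ₜ[k] d

/-- A bialgebra is a left comodule algebra over itself via its comultiplication. -/
@[reducible]
def LeftComoduleAlgebra.self (k A : Type u) [Field k] [Ring A] [Bialgebra k A] :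
    LeftComoduleAlgebra k A A where
  coact := Bialgebra.comulAlgHom k A
  coassoc a := Coalgebra.coassoc_apply a
  counit_coact a := Coalgebra.rTensor_counit_comul a

namespace FinMod

open LeftComoduleAlgebra

variable {k A D : Type u} [Field k] [Ring A] [Bialgebra k A] [Ring D] [Algebra k D]

section Outer

variable {V W U : Type u} [AddCommGroup V] [Module k V] [AddCommGroup W] [Module k W]
  [AddCommGroup U] [Module k U]

/-- If `A` acts on `V` and `D` acts on `W`, then `A ⊗ D` acts on `V ⊗ W`, by
`(a ⊗ d)(v ⊗ w) = av ⊗ dw`. -/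
noncomputable def outer {B : Type u} [Ring B] [Algebra k B] (ρ : B →ₐ[k] Module.End k V)
    (σ : D →ₐ[k] Module.End k W) : B ⊗[k] D →ₐ[k] Module.End k (V ⊗[k] W) :=
  (Module.endTensorEndAlgHom (R := k) (S := k) (A := k)).comp (Algebra.TensorProduct.map ρ σ)

theorem assoc_outer_aux (ρ : A →ₐ[k] Module.End k V) (σ : A →ₐ[k] Module.End k W)
    (τ : D →ₐ[k] Module.End k U) (s : A ⊗[k] A) (d : D) (x : V ⊗[k] W) (u : U) :
    TensorProduct.assoc k V W U (outer ρ σ s x ⊗ₜ τ d u) =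
      outer ρ (outer σ τ) (TensorProduct.assoc k A A D (s ⊗ₜ d))
        (TensorProduct.assoc k V W U (x ⊗ₜ u)) := by
  induction s with
  | zero => simp
  | add s t hs ht => simp [TensorProduct.add_tmul, hs, ht]
  | tmul a b =>
    induction x with
    | zero => simp
    | add x y hx hy => simp only [map_add, TensorProduct.add_tmul, hx, hy]
    | tmul v w => rfl

theorem assoc_outer (ρ : A →ₐ[k] Module.End k V) (σ : A →ₐ[k] Module.End k W)
    (τ : D →ₐ[k] Module.End k U) (t : A ⊗[k] D) (y : (V ⊗[k] W) ⊗[k] U) :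
    TensorProduct.assoc k V W U
        (outer ((outer ρ σ).comp (Bialgebra.comulAlgHom k A)) τ t y) =
      outer ρ (outer σ τ) (TensorProduct.assoc k A A D
        (TensorProduct.map (Coalgebra.comul (R := k) (A := A)) LinearMap.id t))
        (TensorProduct.assoc k V W U y) := by
  induction t with
  | zero => simp
  | add s t hs ht => simp [hs, ht]
  | tmul a d =>
    induction y with
    | zero => simp
    | add x y hx hy => simp only [map_add, hx, hy]
    | tmul x u => exact assoc_outer_aux ρ σ τ (Coalgebra.comul a) d x u

theorem outer_comp (ρ : A →ₐ[k] Module.End k V) (σ : A →ₐ[k] Module.End k W)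
    (τ : D →ₐ[k] Module.End k U) (δ : D →ₐ[k] A ⊗[k] D) (t : A ⊗[k] D)
    (z : V ⊗[k] (W ⊗[k] U)) :
    outer ρ ((outer σ τ).comp δ) t z =
      outer ρ (outer σ τ) (TensorProduct.map LinearMap.id δ.toLinearMap t) z := by
  induction t with
  | zero => simp
  | add s t hs ht => simp [hs, ht]
  | tmul a d =>
    induction z with
    | zero => simp
    | add x y hx hy => simp only [map_add, hx, hy]
    | tmul x u => rfl

theorem lid_outer (τ : D →ₐ[k] Module.End k W) (t : A ⊗[k] D) (x : k ⊗[k] W) :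
    TensorProduct.lid k W
        (outer ((Algebra.lmul k k).comp (Bialgebra.counitAlgHom k A)) τ t x) =
      τ (TensorProduct.lid k D
        (TensorProduct.map (Coalgebra.counit (R := k) (A := A)) LinearMap.id t))
        (TensorProduct.lid k W x) := by
  induction t with
  | zero => simp
  | add s t hs ht => simp [hs, ht]
  | tmul a d =>
    induction x with
    | zero => simp
    | add x y hx hy => simp only [map_add, hx, hy]
    | tmul c w =>
      change (Coalgebra.counit (R := k) a * c) • τ d w = _
      simp [mul_smul, smul_comm c]

theorem rid_outer (ρ : A →ₐ[k] Module.End k V) (t : A ⊗[k] A) (x : V ⊗[k] k) :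
    TensorProduct.rid k V
        (outer ρ ((Algebra.lmul k k).comp (Bialgebra.counitAlgHom k A)) t x) =
      ρ (TensorProduct.rid k A
        (TensorProduct.map LinearMap.id (Coalgebra.counit (R := k) (A := A)) t))
        (TensorProduct.rid k V x) := by
  induction t with
  | zero => simp
  | add s t hs ht => simp [hs, ht]
  | tmul a d =>
    induction x with
    | zero => simp
    | add x y hx hy => simp only [map_add, hx, hy]
    | tmul v c =>
      change (Coalgebra.counit (R := k) d * c) • ρ a v = _
      simp [mul_smul, smul_comm c]

end Outer

theorem map_outer {V V' : FinMod k A} {W W' : FinMod k D} (f : V ⟶ V') (g : W ⟶ W')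
    (t : A ⊗[k] D) (x : V ⊗[k] W) :
    TensorProduct.map (lin f) (lin g) (outer V.ρ W.ρ t x) =
      outer V'.ρ W'.ρ t (TensorProduct.map (lin f) (lin g) x) := by
  induction t with
  | zero => simp
  | add s t hs ht => simp [hs, ht]
  | tmul a d =>
    induction x with
    | zero => simp
    | add x y hx hy => simp only [map_add, hx, hy]
    | tmul v w =>
      change lin f (V.ρ a v) ⊗ₜ lin g (W.ρ d w) = V'.ρ a (lin f v) ⊗ₜ W'.ρ d (lin g w)
      rw [lin_comm, lin_comm]

/-- `V ⊗ W` as a module over the comodule algebra `D`: the action is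
`d (v ⊗ w) = ∑ d₍₋₁₎ v ⊗ d₍₀₎ w` where `d ↦ ∑ d₍₋₁₎ ⊗ d₍₀₎` is the coaction. -/
noncomputable def act [LeftComoduleAlgebra k A D] (V : FinMod k A) (W : FinMod k D) :
    FinMod k D where
  carrier := V ⊗[k] W
  ρ := (outer V.ρ W.ρ).comp (coact (k := k) (A := A))

/-- The trivial module, given by the counit. -/
noncomputable def unit (k A : Type u) [Field k] [Ring A] [Bialgebra k A] : FinMod k A where
  carrier := k
  ρ := (Algebra.lmul k k).comp (Bialgebra.counitAlgHom k A)

/-- The tensor product of morphisms. -/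
noncomputable def actMap [LeftComoduleAlgebra k A D] {V V' : FinMod k A} {W W' : FinMod k D}
    (f : V ⟶ V') (g : W ⟶ W') : act V W ⟶ act V' W' :=
  ofLin (V := act V W) (W := act V' W') (TensorProduct.map (lin f) (lin g))
    fun d x => map_outer f g (coact d) x

/-- The tensor product of two modules over a bialgebra, with the diagonal action. -/
noncomputable def tensor (V W : FinMod k A) : FinMod k A :=
  letI := LeftComoduleAlgebra.self k A
  act V W

/-- `(V ⊗ W) ⊗ U ≅ V ⊗ (W ⊗ U)`, with the usual underlying map. -/
noncomputable def assocIso [LeftComoduleAlgebra k A D] (V W : FinMod k A) (U : FinMod k D) :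
    act (tensor V W) U ≅ act V (act W U) :=
  isoOfLin (V := act (tensor V W) U) (W := act V (act W U)) (TensorProduct.assoc k V W U)
    fun d x => by
      refine (assoc_outer V.ρ W.ρ U.ρ (coact d) x).trans ?_
      rw [coassoc]
      exact (outer_comp V.ρ W.ρ U.ρ coact (coact d) _).symm

/-- `k ⊗ W ≅ W`, with the usual underlying map. -/
noncomputable def unitIso [LeftComoduleAlgebra k A D] (W : FinMod k D) :
    act (unit k A) W ≅ W :=
  isoOfLin (V := act (unit k A) W) (W := W) (TensorProduct.lid k W) fun d x => by
      refine (lid_outer W.ρ (coact d) x).trans ?_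
      rw [counit_coact, TensorProduct.lid_tmul, one_smul]
      rfl

/-- `V ⊗ k ≅ V`, with the usual underlying map. -/
noncomputable def rightUnitIso (V : FinMod k A) : tensor V (unit k A) ≅ V :=
  isoOfLin (V := tensor V (unit k A)) (W := V) (TensorProduct.rid k V) fun a x => by
      refine (rid_outer V.ρ (Coalgebra.comul a) x).trans ?_
      have h : TensorProduct.map LinearMap.id (Coalgebra.counit (R := k) (A := A))
        (Coalgebra.comul a) = a ⊗ₜ[k] (1 : k) := Coalgebra.lTensor_counit_comul a
      rw [h, TensorProduct.rid_tmul, one_smul]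
      rfl

section Monoidal

attribute [local instance] LeftComoduleAlgebra.self

/-- The monoidal category of finite-dimensional modules over a bialgebra. -/
noncomputable instance : MonoidalCategory (FinMod k A) where
  tensorObj V W := tensor V W
  tensorUnit := unit k A
  tensorHom f g := actMap f g
  whiskerLeft V _ _ f := actMap (𝟙 V) f
  whiskerRight f W := actMap f (𝟙 W)
  associator V W U := assocIso V W U
  leftUnitor V := unitIso V
  rightUnitor V := rightUnitIso V
  tensorHom_def _ _ := hom_ext (TensorProduct.ext' fun _ _ => rfl)
  id_tensorHom_id _ _ := hom_ext (TensorProduct.ext' fun _ _ => rfl)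
  tensorHom_comp_tensorHom _ _ _ _ := hom_ext (TensorProduct.ext' fun _ _ => rfl)
  whiskerLeft_id _ _ := hom_ext (TensorProduct.ext' fun _ _ => rfl)
  id_whiskerRight _ _ := hom_ext (TensorProduct.ext' fun _ _ => rfl)
  associator_naturality _ _ _ := hom_ext (TensorProduct.ext_threefold fun _ _ _ => rfl)
  leftUnitor_naturality f := hom_ext (TensorProduct.ext' fun c v => ((lin f).map_smul c v).symm)
  rightUnitor_naturality f := hom_ext (TensorProduct.ext' fun v c => ((lin f).map_smul c v).symm)
  pentagon _ _ _ _ := hom_ext (TensorProduct.ext_fourfold fun _ _ _ _ => rfl)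
  triangle _ _ := hom_ext (TensorProduct.ext_threefold fun v (c : k) w =>
    (TensorProduct.smul_tmul c v w).symm)

end Monoidal

/-- If `D` is a comodule algebra over the bialgebra `A`, then the finite-dimensional modules over
`A` act on those over `D`. -/
noncomputable instance [LeftComoduleAlgebra k A D] :
    MonoidalLeftAction (FinMod k A) (FinMod k D) where
  actionObj V W := act V W
  actionHom f g := actMap f g
  actionHomLeft f W := actMap f (𝟙 W)
  actionHomRight V _ _ g := actMap (𝟙 V) g
  actionAssocIso V W U := assocIso V W U
  actionUnitIso W := unitIso W
  actionHom_def _ _ := hom_ext (TensorProduct.ext' fun _ _ => rfl)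
  actionHomRight_id _ _ := hom_ext (TensorProduct.ext' fun _ _ => rfl)
  id_actionHomLeft _ _ := hom_ext (TensorProduct.ext' fun _ _ => rfl)
  actionHom_comp _ _ _ _ := hom_ext (TensorProduct.ext' fun _ _ => rfl)
  actionAssocIso_hom_naturality _ _ _ := hom_ext (TensorProduct.ext_threefold fun _ _ _ => rfl)
  actionUnitIso_hom_naturality f :=
    hom_ext (TensorProduct.ext' fun c v => (lin f).map_smul c v)
  whiskerLeft_actionHomLeft _ _ _ _ _ := hom_ext (TensorProduct.ext_threefold fun _ _ _ => rfl)
  whiskerRight_actionHomLeft _ _ _ := hom_ext (TensorProduct.ext_threefold fun _ _ _ => rfl)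
  associator_actionHom _ _ _ _ := hom_ext (TensorProduct.ext_fourfold fun _ _ _ _ => rfl)
  leftUnitor_actionHom _ _ := hom_ext (TensorProduct.ext_threefold fun (c : k) v w =>
    TensorProduct.smul_tmul' c v w)
  rightUnitor_actionHom _ _ := hom_ext (TensorProduct.ext_threefold fun v (c : k) w =>
    TensorProduct.smul_tmul c v w)

end FinMod

/-! ### Grothendieck groups -/

/-- The subgroup generated by `[Y] - [X] - [Z]` for the short exact sequences `0 → X → Y → Z → 0`
of finite-dimensional `A`-modules. -/
def grRel (k A : Type u) [Field k] [Ring A] [Algebra k A] :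
    AddSubgroup (FreeAbelianGroup (FinMod k A)) :=
  AddSubgroup.closure {x | ∃ (X Y Z : FinMod k A) (f : X ⟶ Y) (g : Y ⟶ Z),
    Function.Injective (FinMod.lin f) ∧ Function.Exact (FinMod.lin f) (FinMod.lin g) ∧
    Function.Surjective (FinMod.lin g) ∧
    x = FreeAbelianGroup.of Y - FreeAbelianGroup.of X - FreeAbelianGroup.of Z}

/-- The Grothendieck group `Gr(A)` of the category of finite-dimensional `A`-modules. -/
def Gr (k A : Type u) [Field k] [Ring A] [Algebra k A] : Type (u + 1) :=
  FreeAbelianGroup (FinMod k A) ⧸ grRel k A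

namespace Gr

open FinMod

section Group

variable {k A : Type u} [Field k] [Ring A] [Algebra k A]

instance : AddCommGroup (Gr k A) :=
  inferInstanceAs (AddCommGroup (FreeAbelianGroup (FinMod k A) ⧸ grRel k A))

/-- The class of a module in the Grothendieck group. -/
def cls (X : FinMod k A) : Gr k A := QuotientAddGroup.mk (FreeAbelianGroup.of X)

theorem cls_add {X Y Z : FinMod k A} (f : X ⟶ Y) (g : Y ⟶ Z)
    (hf : Function.Injective (lin f)) (hfg : Function.Exact (lin f) (lin g))
    (hg : Function.Surjective (lin g)) : cls Y = cls X + cls Z := by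
  have h : FreeAbelianGroup.of Y - FreeAbelianGroup.of X - FreeAbelianGroup.of Z ∈ grRel k A :=
    AddSubgroup.subset_closure ⟨X, Y, Z, f, g, hf, hfg, hg, rfl⟩
  have h' : cls Y - cls X - cls Z = 0 := (QuotientAddGroup.eq_zero_iff _).2 h
  rw [sub_sub, sub_eq_zero] at h'
  exact h'

/-- An additive invariant of modules factors through the Grothendieck group. -/
def lift {G : Type*} [AddCommGroup G] (φ : FinMod k A → G)
    (hφ : ∀ {X Y Z : FinMod k A} (f : X ⟶ Y) (g : Y ⟶ Z), Function.Injective (lin f) →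
      Function.Exact (lin f) (lin g) → Function.Surjective (lin g) → φ Y = φ X + φ Z) :
    Gr k A →+ G :=
  QuotientAddGroup.lift (grRel k A) (FreeAbelianGroup.lift φ) (by
    refine (AddSubgroup.closure_le _).2 ?_
    rintro _ ⟨X, Y, Z, f, g, hf, hfg, hg, rfl⟩
    change FreeAbelianGroup.lift φ _ = 0
    simp [hφ f g hf hfg hg])

@[simp] theorem lift_cls {G : Type*} [AddCommGroup G] (φ : FinMod k A → G) (hφ)
    (X : FinMod k A) : lift φ hφ (cls X) = φ X :=
  FreeAbelianGroup.lift_apply_of φ X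

@[elab_as_elim]
theorem induction {p : Gr k A → Prop} (x : Gr k A) (h0 : p 0) (h1 : ∀ X, p (cls X))
    (hneg : ∀ x, p x → p (-x)) (hadd : ∀ x y, p x → p y → p (x + y)) : p x := by
  obtain ⟨x, rfl⟩ := QuotientAddGroup.mk_surjective x
  induction x using FreeAbelianGroup.induction_on with
  | zero => exact h0
  | of X => exact h1 X
  | neg X _ => exact hneg _ (h1 X)
  | add x y hx hy => exact hadd _ _ hx hy

theorem cls_zero : cls (FinMod.zero : FinMod k A) = 0 := by
  have h := cls_add (𝟙 (FinMod.zero : FinMod k A)) (𝟙 _) (fun _ _ h => h)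
    (fun x => ⟨fun _ => ⟨x, rfl⟩, fun _ => rfl⟩) (fun x => ⟨x, rfl⟩)
  exact left_eq_add.1 h

theorem cls_iso {X Y : FinMod k A} (e : X ≅ Y) : cls X = cls Y := by
  have h1 : ∀ x, lin e.inv (lin e.hom x) = x := fun x => by
    rw [← LinearMap.comp_apply, ← lin_comp, e.hom_inv_id]; rfl
  have h2 : ∀ y, lin e.hom (lin e.inv y) = y := fun y => by
    rw [← LinearMap.comp_apply, ← lin_comp, e.inv_hom_id]; rfl
  have h := cls_add e.hom (0 : Y ⟶ FinMod.zero) (Function.LeftInverse.injective h1)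
    (fun y => ⟨fun _ => ⟨_, h2 y⟩, fun _ => rfl⟩) (fun x => ⟨0, Subsingleton.elim (α := PUnit) _ _⟩)
  rw [cls_zero, add_zero] at h
  exact h.symm

/-- The class of an isomorphism class of simple modules. -/
def irr : Irr (FinMod k A) → Gr k A :=
  Quotient.lift (fun S => cls S.1) fun _ _ ⟨e⟩ => cls_iso e

end Group

section Action

variable {k A D : Type u} [Field k] [Ring A] [Bialgebra k A] [Ring D] [Algebra k D]

/-- The biadditive map `Gr(A) × Gr(D) → Gr(D)` with `[V] · [W] = [V ⊗ W]`. -/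
noncomputable def actHom [LeftComoduleAlgebra k A D] : Gr k A →+ Gr k D →+ Gr k D :=
  lift (fun V => lift (fun W => cls (act V W)) (fun {X Y Z} f g hf hfg hg =>
      cls_add (actMap (𝟙 V) f) (actMap (𝟙 V) g)
        (Module.Flat.lTensor_preserves_injective_linearMap (M := V) (lin f) hf)
        (lTensor_exact V hfg hg) (LinearMap.lTensor_surjective V hg)))
    (fun {X Y Z} f g hf hfg hg => by
      ext x
      induction x using induction with
      | h0 => simp
      | h1 W =>
        rw [AddMonoidHom.add_apply, lift_cls, lift_cls, lift_cls]
        exact cls_add (actMap f (𝟙 W)) (actMap g (𝟙 W))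
          (Module.Flat.rTensor_preserves_injective_linearMap (M := W) (lin f) hf)
          (rTensor_exact W hfg hg) (LinearMap.rTensor_surjective W hg)
      | hneg x hx => rw [map_neg, map_neg, hx]
      | hadd x y hx hy => rw [map_add, map_add, hx, hy])

theorem actHom_cls [LeftComoduleAlgebra k A D] (V : FinMod k A) (W : FinMod k D) :
    actHom (cls V) (cls W) = cls (act V W) := by
  simp [actHom]

/-- The product of `Gr(A)` for a bialgebra `A`: `[V] [W] = [V ⊗ W]`. -/
noncomputable def mulHom : Gr k A →+ Gr k A →+ Gr k A :=
  letI := LeftComoduleAlgebra.self k A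
  actHom

theorem mulHom_cls (V W : FinMod k A) : mulHom (cls V) (cls W) = cls (tensor V W) :=
  letI := LeftComoduleAlgebra.self k A
  actHom_cls V W

theorem actHom_mulHom [LeftComoduleAlgebra k A D] (x y : Gr k A) (z : Gr k D) :
    actHom (mulHom x y) z = actHom x (actHom y z) := by
  induction x using induction with
  | h0 => simp
  | hneg x hx => simp [hx]
  | hadd x x' hx hx' => simp [hx, hx']
  | h1 V =>
    induction y using induction with
    | h0 => simp
    | hneg x hx => simp [hx]
    | hadd x x' hx hx' => simp [hx, hx']
    | h1 W =>
      induction z using induction with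
      | h0 => simp
      | hneg x hx => simp [hx]
      | hadd x x' hx hx' => simp [hx, hx']
      | h1 U =>
        rw [mulHom_cls, actHom_cls, actHom_cls, actHom_cls]
        exact cls_iso (assocIso V W U)

theorem one_actHom [LeftComoduleAlgebra k A D] (z : Gr k D) :
    actHom (cls (unit k A)) z = z := by
  induction z using induction with
  | h0 => simp
  | hneg x hx => simp [hx]
  | hadd x x' hx hx' => simp [hx, hx']
  | h1 U =>
    rw [actHom_cls]
    exact cls_iso (unitIso U)

theorem mulHom_one (x : Gr k A) : mulHom x (cls (unit k A)) = x := by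
  induction x using induction with
  | h0 => simp
  | hneg x hx => simp [hx]
  | hadd x x' hx hx' => simp [hx, hx']
  | h1 U =>
    rw [mulHom_cls]
    exact cls_iso (rightUnitIso U)

/-- The Grothendieck ring of a bialgebra. -/
noncomputable instance : Ring (Gr k A) :=
  letI := LeftComoduleAlgebra.self k A
  { (inferInstance : AddCommGroup (Gr k A)) with
    mul := fun x y => mulHom x y
    one := cls (unit k A)
    left_distrib := fun x y z => map_add (mulHom x) y z
    right_distrib := fun x y z => by
      change mulHom (x + y) z = mulHom x z + mulHom y z
      rw [map_add, AddMonoidHom.add_apply]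
    zero_mul := fun x => by
      change mulHom 0 x = 0
      rw [map_zero, AddMonoidHom.zero_apply]
    mul_zero := fun x => map_zero (mulHom x)
    mul_assoc := fun x y z => actHom_mulHom x y z
    one_mul := fun x => one_actHom x
    mul_one := fun x => mulHom_one x }

/-- `Gr(D)` as a module over the Grothendieck ring `Gr(A)`, by `[V] • [W] = [V ⊗ W]`. -/
noncomputable instance [LeftComoduleAlgebra k A D] : Module (Gr k A) (Gr k D) where
  smul x y := actHom x y
  one_smul x := one_actHom x
  mul_smul x y z := actHom_mulHom x y z
  smul_zero x := map_zero (actHom x)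
  smul_add x y z := map_add (actHom x) y z
  add_smul x y z := by
    change actHom (x + y) z = actHom x z + actHom y z
    rw [map_add, AddMonoidHom.add_apply]
  zero_smul x := by
    change actHom 0 x = 0
    rw [map_zero, AddMonoidHom.zero_apply]

end Action

end Gr

/-! ### Hopf algebras that are finite over a central Hopf subalgebra, and their fiber algebras -/

/-- `H` is an affine (finitely generated) Hopf algebra over `k` and `C` is a central Hopf subalgebra
such that `H` is a finitely generated `C`-module. -/
class FinHopf {k H : Type u} [Field k] [Ring H] [HopfAlgebra k H] (C : Subalgebra k H) :
    Prop where
  affine : Algebra.FiniteType k H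
  central : C ≤ Subalgebra.center k H
  comul_mem : ∀ c ∈ C, Coalgebra.comul (R := k) c ∈
    LinearMap.range (TensorProduct.map C.val.toLinearMap C.val.toLinearMap)
  antipode_mem : ∀ c ∈ C, HopfAlgebra.antipode k c ∈ C
  finite : Module.Finite C H

section Fiber

variable {k H : Type u} [Field k] [Ring H] [HopfAlgebra k H] (C : Subalgebra k H)

/-- The ideal `𝔪H` of `H` generated by an ideal `𝔪` of `C`. -/
def fiberIdeal (𝔪 : Ideal C) : Ideal H := Ideal.map C.val 𝔪

/-- The augmentation ideal of `C`: the kernel of the restriction of the counit to `C`. -/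
def augIdeal : Ideal C := RingHom.ker ((Bialgebra.counitAlgHom k H).comp C.val)

instance [FinHopf C] (𝔪 : Ideal C) : (fiberIdeal C 𝔪).IsTwoSided where
  mul_mem_of_left {a} b ha := by
    induction ha using Submodule.span_induction with
    | zero => simp
    | add x y _ _ hx hy => rw [add_mul]; exact Ideal.add_mem _ hx hy
    | smul r x _ hx => rw [smul_eq_mul, mul_assoc]; exact Ideal.mul_mem_left _ _ hx
    | mem x hx =>
      obtain ⟨c, hc, rfl⟩ := hx
      have h : (c : H) * b = b * c :=
        (Subalgebra.mem_center_iff.1 (FinHopf.central c.2) b).symm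
      change (c : H) * b ∈ _
      rw [h]
      exact Ideal.mul_mem_left _ _ (Ideal.mem_map_of_mem C.val hc)

/-- The fiber algebra `H/𝔪H`. -/
abbrev Fiber (𝔪 : Ideal C) : Type u := H ⧸ fiberIdeal C 𝔪

theorem mk_eq_zero_of_mem [FinHopf C] {𝔪 : Ideal C} {c : C} (hc : c ∈ 𝔪) :
    (Ideal.Quotient.mk (fiberIdeal C 𝔪) (c : H)) = 0 :=
  Ideal.Quotient.eq_zero_iff_mem.2 (Ideal.mem_map_of_mem C.val hc)

theorem mk_augIdeal [FinHopf C] (c : C) :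
    Ideal.Quotient.mkₐ k (fiberIdeal C (augIdeal C)) (c : H) =
      algebraMap k _ (Coalgebra.counit (R := k) (c : H)) := by
  have h : c - algebraMap k C (Coalgebra.counit (R := k) (c : H)) ∈ augIdeal C := by
    simp [augIdeal, RingHom.mem_ker]
  have h2 := mk_eq_zero_of_mem C h
  rw [AddSubgroupClass.coe_sub, map_sub, sub_eq_zero] at h2
  exact h2

/-- The map `H → H/𝔪_ε H ⊗ H/𝔪 H` induced by the comultiplication. -/
noncomputable def preCoact [FinHopf C] (𝔪 : Ideal C) :
    H →ₐ[k] Fiber C (augIdeal C) ⊗[k] Fiber C 𝔪 :=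
  (Algebra.TensorProduct.map (Ideal.Quotient.mkₐ k (fiberIdeal C (augIdeal C)))
    (Ideal.Quotient.mkₐ k (fiberIdeal C 𝔪))).comp (Bialgebra.comulAlgHom k H)

theorem preCoact_coe [FinHopf C] (𝔪 : Ideal C) (c : C) :
    preCoact C 𝔪 c = 1 ⊗ₜ Ideal.Quotient.mkₐ k (fiberIdeal C 𝔪) (c : H) := by
  have key : ∀ t : C ⊗[k] C,
      TensorProduct.map (Ideal.Quotient.mkₐ k (fiberIdeal C (augIdeal C))).toLinearMap
        (Ideal.Quotient.mkₐ k (fiberIdeal C 𝔪)).toLinearMap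
        (TensorProduct.map C.val.toLinearMap C.val.toLinearMap t) =
      1 ⊗ₜ Ideal.Quotient.mkₐ k (fiberIdeal C 𝔪) (TensorProduct.lid k H
        (TensorProduct.map (Coalgebra.counit (R := k) (A := H)) LinearMap.id
          (TensorProduct.map C.val.toLinearMap C.val.toLinearMap t))) := by
    intro t
    induction t with
    | zero => simp
    | add s t hs ht => simp only [map_add, hs, ht, TensorProduct.tmul_add]
    | tmul a b =>
      change Ideal.Quotient.mkₐ k (fiberIdeal C (augIdeal C)) (a : H) ⊗ₜ
          Ideal.Quotient.mkₐ k (fiberIdeal C 𝔪) (b : H) =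
        1 ⊗ₜ Ideal.Quotient.mkₐ k (fiberIdeal C 𝔪)
          (Coalgebra.counit (R := k) (a : H) • (b : H))
      rw [mk_augIdeal, Algebra.algebraMap_eq_smul_one, TensorProduct.smul_tmul, map_smul]
  obtain ⟨t, ht⟩ := FinHopf.comul_mem (c : H) c.2
  have h := key t
  rw [ht] at h
  have h2 : TensorProduct.map (Coalgebra.counit (R := k) (A := H)) LinearMap.id
    (Coalgebra.comul (c : H)) = (1 : k) ⊗ₜ[k] (c : H) := Coalgebra.rTensor_counit_comul _
  rw [h2, TensorProduct.lid_tmul, one_smul] at h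
  exact h

theorem preCoact_eq_zero [FinHopf C] (𝔪 : Ideal C) (x : H) (hx : x ∈ fiberIdeal C 𝔪) :
    preCoact C 𝔪 x = 0 := by
  have h : fiberIdeal C 𝔪 ≤ RingHom.ker (preCoact C 𝔪) := by
    refine Ideal.map_le_iff_le_comap.2 fun c hc => ?_
    rw [Ideal.mem_comap, RingHom.mem_ker]
    refine (preCoact_coe C 𝔪 c).trans ?_
    rw [Ideal.Quotient.mkₐ_eq_mk, mk_eq_zero_of_mem C hc, TensorProduct.tmul_zero]
  exact h hx

/-- `𝔪_ε H` is a Hopf ideal, so that `H/𝔪_ε H` is a Hopf algebra. -/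
instance [FinHopf C] : (fiberIdeal C (augIdeal C)).IsHopfIdeal k where
  counit_eq_zero x hx := by
    have h : fiberIdeal C (augIdeal C) ≤ RingHom.ker (Bialgebra.counitAlgHom k H) :=
      Ideal.map_le_iff_le_comap.2 fun c hc => hc
    exact h hx
  map_mkQ_comul_eq_zero x hx := preCoact_eq_zero C (augIdeal C) x hx
  antipode_mem x hx := by
    induction hx using Submodule.span_induction with
    | zero => simp
    | add x y _ _ hx hy => rw [map_add]; exact Ideal.add_mem _ hx hy
    | smul r x _ hx =>
      rw [smul_eq_mul, HopfAlgebra.antipode_mul_antidistrib]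
      exact Ideal.mul_mem_right _ _ hx
    | mem x hx =>
      obtain ⟨c, hc, rfl⟩ := hx
      refine Ideal.mem_map_of_mem C.val (x := ⟨_, FinHopf.antipode_mem (c : H) c.2⟩) ?_
      exact (HopfAlgebra.counit_antipode (R := k) (c : H)).trans hc

/-- `H/𝔪H` is a left comodule algebra over `H/𝔪_ε H`, with coaction induced by the
comultiplication of `H`. -/
noncomputable instance [FinHopf C] (𝔪 : Ideal C) :
    LeftComoduleAlgebra k (Fiber C (augIdeal C)) (Fiber C 𝔪) where
  coact := Ideal.Quotient.liftₐ (fiberIdeal C 𝔪) (preCoact C 𝔪) (preCoact_eq_zero C 𝔪)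
  coassoc d := by
    obtain ⟨h, rfl⟩ := Ideal.Quotient.mk_surjective d
    let p := (Ideal.Quotient.mkₐ k (fiberIdeal C (augIdeal C))).toLinearMap
    let q := (Ideal.Quotient.mkₐ k (fiberIdeal C 𝔪)).toLinearMap
    have h1 : ∀ s : H ⊗[k] H, TensorProduct.assoc k _ _ _
        (TensorProduct.map (Coalgebra.comul (R := k)) LinearMap.id (TensorProduct.map p q s)) =
        TensorProduct.map p (TensorProduct.map p q) (TensorProduct.assoc k H H H
          (TensorProduct.map (Coalgebra.comul (R := k)) LinearMap.id s)) := by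
      intro s
      induction s with
      | zero => simp
      | add s t hs ht => simp only [map_add, hs, ht]
      | tmul a b =>
        change TensorProduct.assoc k _ _ _ (TensorProduct.map p p (Coalgebra.comul a) ⊗ₜ q b) =
          TensorProduct.map p (TensorProduct.map p q)
            (TensorProduct.assoc k H H H (Coalgebra.comul a ⊗ₜ b))
        generalize Coalgebra.comul (R := k) a = t
        induction t with
        | zero => simp
        | add s t hs ht => simp only [map_add, TensorProduct.add_tmul, hs, ht]
        | tmul x y => rfl
    have h2 : ∀ s : H ⊗[k] H, TensorProduct.map LinearMap.id
        (Ideal.Quotient.liftₐ (fiberIdeal C 𝔪) (preCoact C 𝔪)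
          (preCoact_eq_zero C 𝔪)).toLinearMap (TensorProduct.map p q s) =
        TensorProduct.map p (TensorProduct.map p q)
          (TensorProduct.map LinearMap.id (Coalgebra.comul (R := k)) s) := by
      intro s
      induction s with
      | zero => simp
      | add s t hs ht => simp only [map_add, hs, ht]
      | tmul a b => rfl
    refine (h1 (Coalgebra.comul h)).trans (Eq.trans ?_ (h2 (Coalgebra.comul h)).symm)
    exact congrArg _ (Coalgebra.coassoc_apply h)
  counit_coact d := by
    obtain ⟨h, rfl⟩ := Ideal.Quotient.mk_surjective d
    let p := (Ideal.Quotient.mkₐ k (fiberIdeal C (augIdeal C))).toLinearMap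
    let q := (Ideal.Quotient.mkₐ k (fiberIdeal C 𝔪)).toLinearMap
    have h1 : ∀ s : H ⊗[k] H,
        TensorProduct.map (Coalgebra.counit (R := k)) LinearMap.id (TensorProduct.map p q s) =
        TensorProduct.map LinearMap.id q
          (TensorProduct.map (Coalgebra.counit (R := k)) LinearMap.id s) := by
      intro s
      induction s with
      | zero => simp
      | add s t hs ht => simp only [map_add, hs, ht]
      | tmul a b => rfl
    refine (h1 (Coalgebra.comul h)).trans ?_
    have h2 : TensorProduct.map (Coalgebra.counit (R := k) (A := H)) LinearMap.id
      (Coalgebra.comul h) = (1 : k) ⊗ₜ[k] h := Coalgebra.rTensor_counit_comul _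
    rw [h2]
    rfl

end Fiber

/-!
Write `A = H/𝔪_ε H` and `D = H/𝔪H`. Everything rests on the map `τ : A → D ⊗ D` induced by
`h ↦ ∑ h₍₁₎ ⊗ S(h₍₂₎)` (`FinMod.translation`). It descends to the fibers because `C` acts on `D` by
scalars, and it inverts the canonical map: `D ⊗ D → A ⊗ D`, `d ⊗ e ↦ δ(d)(1 ⊗ e)`, is bijective, that
is, `D` is a Galois object over `A` (`FinMod.IsGalois`, `FinMod.isGalois_fiber`).

* Finiteness. `C` is finitely generated by the Artin–Tate lemma, so its residue fields are `k` by the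
  Nullstellensatz, and `A` and `D` are finite-dimensional; `D ≠ 0` by Nakayama's lemma. For a
  finite-dimensional algebra the category of finite-dimensional modules is finite
  (`FinMod.isFiniteAbelian`). Jacobson density provides, for finitely many pairwise non-isomorphic
  simple modules, elements acting as prescribed on each of them; this bounds the number of simple
  modules by the dimension of the algebra and shows that their classes are linearly independent in
  the Grothendieck group, while composition series show that they span (`Gr.irrBasis`).

* Rigidity. The duals on one side come from the antipode and those on the other side from its
  inverse. That the antipode of a finite-dimensional Hopf algebra is bijective is proved with a
  nonzero integral, which is obtained from the freeness of `A ⊗ A*`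
  (`FinMod.exists_integral`, `FinMod.antipode_surjective`, `FinMod.isFiniteTensorCategory`).

* Exactness, indecomposability, irreducibility. By the Galois property `A ⊗ W` is a free `D`-module
  for every `D`-module `W`, on the vector space `W`. Hence `P ⊗ W` is projective for every projective
  `P` (`FinMod.isExactModuleCategory`), and every `D`-module is a quotient of a power of `A ⊗ W` as
  soon as `W ≠ 0`. So no nonzero proper part of the category, and no nonempty proper set of simple
  classes, is stable under the action (`FinMod.isIndecomposableModuleCategory`,
  `FinMod.isIrreducibleZPlusModule`).
-/

/-! ### The abelian category of finite-dimensional modules -/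

namespace FinMod

section AbelianStructure

variable {k A : Type u} [Field k] [Ring A] [Algebra k A]

theorem comp_eq_zero_iff {V W X : FinMod k A} (f : V ⟶ W) (g : W ⟶ X) :
    f ≫ g = 0 ↔ ∀ v, lin g (lin f v) = 0 :=
  ⟨fun h v => LinearMap.congr_fun (congrArg lin h) v, fun h => hom_ext (LinearMap.ext h)⟩

/-- An invariant subspace as a submodule. -/
def sub (V : FinMod k A) (p : Submodule k V) (hp : ∀ a, ∀ v ∈ p, V.ρ a v ∈ p) : FinMod k A where
  carrier := p
  ρ :=
    { toFun := fun a => (V.ρ a).restrict (hp a)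
      map_one' := by ext; simp
      map_mul' := fun a b => by ext; simp
      map_zero' := by ext; simp
      map_add' := fun a b => by ext; simp
      commutes' := fun r => by ext; simp }

/-- The inclusion of an invariant subspace. -/
def subIncl (V : FinMod k A) (p : Submodule k V) (hp : ∀ a, ∀ v ∈ p, V.ρ a v ∈ p) :
    sub V p hp ⟶ V :=
  ofLin (V := sub V p hp) p.subtype fun _ _ => rfl

/-- The quotient by an invariant subspace. -/
def quot (V : FinMod k A) (p : Submodule k V) (hp : ∀ a, ∀ v ∈ p, V.ρ a v ∈ p) : FinMod k A where
  carrier := V ⧸ p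
  ρ :=
    { toFun := fun a => p.mapQ p (V.ρ a) (hp a)
      map_one' := by ext; simp
      map_mul' := fun a b => by ext; simp
      map_zero' := by ext; simp
      map_add' := fun a b => by ext; simp
      commutes' := fun r => by ext; simp }

/-- The projection to the quotient by an invariant subspace. -/
def quotProj (V : FinMod k A) (p : Submodule k V) (hp : ∀ a, ∀ v ∈ p, V.ρ a v ∈ p) :
    V ⟶ quot V p hp :=
  ofLin (W := quot V p hp) p.mkQ fun _ _ => rfl

theorem ker_invariant {V W : FinMod k A} (f : V ⟶ W) (a : A) (v : V)
    (hv : v ∈ LinearMap.ker (lin f)) : V.ρ a v ∈ LinearMap.ker (lin f) := by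
  rw [LinearMap.mem_ker] at *
  rw [lin_comm, hv, map_zero]

theorem range_invariant {V W : FinMod k A} (f : V ⟶ W) (a : A) (w : W)
    (hw : w ∈ LinearMap.range (lin f)) : W.ρ a w ∈ LinearMap.range (lin f) := by
  obtain ⟨v, rfl⟩ := hw
  exact ⟨V.ρ a v, lin_comm f a v⟩

theorem mono_of_injective {V W : FinMod k A} (f : V ⟶ W) (hf : Function.Injective (lin f)) :
    Mono f where
  right_cancellation _ _ e := hom_ext <| LinearMap.ext fun v =>
    hf (LinearMap.congr_fun (congrArg lin e) v)

theorem epi_of_surjective {V W : FinMod k A} (f : V ⟶ W) (hf : Function.Surjective (lin f)) :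
    Epi f where
  left_cancellation _ _ e := hom_ext <| LinearMap.ext fun w => by
    obtain ⟨v, rfl⟩ := hf w
    exact LinearMap.congr_fun (congrArg lin e) v

theorem injective_of_mono {V W : FinMod k A} (f : V ⟶ W) [Mono f] :
    Function.Injective (lin f) := by
  have h : subIncl V _ (ker_invariant f) = 0 := by
    rw [← cancel_mono f, zero_comp]
    exact (comp_eq_zero_iff _ _).2 fun v => v.2
  refine (injective_iff_map_eq_zero _).2 fun v hv => ?_
  exact LinearMap.congr_fun (congrArg lin h) (⟨v, hv⟩ : LinearMap.ker (lin f))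

theorem surjective_of_epi {V W : FinMod k A} (f : V ⟶ W) [Epi f] :
    Function.Surjective (lin f) := by
  have h : quotProj W _ (range_invariant f) = 0 := by
    rw [← cancel_epi f, comp_zero]
    exact (comp_eq_zero_iff _ _).2 fun v => (Submodule.Quotient.mk_eq_zero _).2 ⟨v, rfl⟩
  intro w
  exact (Submodule.Quotient.mk_eq_zero _).1 (LinearMap.congr_fun (congrArg lin h) w)

/-- A bijective morphism is an isomorphism. -/
noncomputable def isoOfBijective {V W : FinMod k A} (f : V ⟶ W)
    (hf : Function.Bijective (lin f)) : V ≅ W :=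
  isoOfLin (LinearEquiv.ofBijective (lin f) hf) (lin_comm f)

theorem isIso_of_bijective {V W : FinMod k A} (f : V ⟶ W) (hf : Function.Bijective (lin f)) :
    IsIso f :=
  (isoOfBijective f hf).isIso_hom

/-- A linearly exact sequence `0 → K → V → W` is a kernel diagram. -/
noncomputable def isLimitOfExact {K V W : FinMod k A} (i : K ⟶ V) (f : V ⟶ W) (w : i ≫ f = 0)
    (hi : Function.Injective (lin i)) (h : Function.Exact (lin i) (lin f)) :
    IsLimit (KernelFork.ofι i w) :=
  have := mono_of_injective i hi
  KernelFork.IsLimit.ofι' i w fun {X} g hg =>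
    have hmem : ∀ x, lin g x ∈ LinearMap.range (lin i) := fun x =>
      (h (lin g x)).1 ((comp_eq_zero_iff g f).1 hg x)
    let e := LinearEquiv.ofInjective (lin i) hi
    have he : ∀ y, lin i (e.symm y) = y := fun y =>
      congrArg Subtype.val (e.apply_symm_apply y)
    ⟨ofLin (e.symm.toLinearMap ∘ₗ (lin g).codRestrict _ hmem) fun a x => hi <| by
        simp only [LinearMap.comp_apply, LinearEquiv.coe_coe]
        rw [lin_comm i, he, he]
        exact lin_comm g a x,
      hom_ext <| LinearMap.ext fun x => he _⟩

/-- A linearly exact sequence `V → W → Q → 0` is a cokernel diagram. -/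
noncomputable def isColimitOfExact {V W Q : FinMod k A} (f : V ⟶ W) (q : W ⟶ Q) (w : f ≫ q = 0)
    (hq : Function.Surjective (lin q)) (h : Function.Exact (lin f) (lin q)) :
    IsColimit (CokernelCofork.ofπ q w) :=
  have := epi_of_surjective q hq
  CokernelCofork.IsColimit.ofπ' q w fun {X} g hg =>
    have hker : LinearMap.ker (lin q) ≤ LinearMap.ker (lin g) := fun y hy => by
      obtain ⟨x, rfl⟩ := (h y).1 hy
      exact (comp_eq_zero_iff f g).1 hg x
    let e := (lin q).quotKerEquivOfSurjective hq
    have he : ∀ y, e.symm (lin q y) = Submodule.Quotient.mk y := fun y =>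
      e.injective ((e.apply_symm_apply _).trans rfl)
    have hl : ∀ y, ((LinearMap.ker (lin q)).liftQ (lin g) hker ∘ₗ e.symm.toLinearMap) (lin q y) =
        lin g y := fun y => by
      rw [LinearMap.comp_apply, LinearEquiv.coe_coe, he, Submodule.liftQ_apply]
    ⟨ofLin ((LinearMap.ker (lin q)).liftQ (lin g) hker ∘ₗ e.symm.toLinearMap) fun a y => by
        obtain ⟨y, rfl⟩ := hq y
        rw [← lin_comm, hl, hl, lin_comm],
      hom_ext <| LinearMap.ext fun x => hl _⟩

theorem exact_subIncl {V W : FinMod k A} (f : V ⟶ W) :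
    Function.Exact (lin (subIncl V _ (ker_invariant f))) (lin f) := fun v =>
  ⟨fun hv => ⟨⟨v, hv⟩, rfl⟩, by rintro ⟨v, rfl⟩; exact v.2⟩

theorem subIncl_injective (V : FinMod k A) (p : Submodule k V) (hp) :
    Function.Injective (lin (subIncl V p hp)) :=
  Subtype.val_injective

theorem subIncl_comp {V W : FinMod k A} (f : V ⟶ W) :
    subIncl V _ (ker_invariant f) ≫ f = 0 :=
  (comp_eq_zero_iff _ _).2 (exact_subIncl f).apply_apply_eq_zero

theorem quotProj_surjective (V : FinMod k A) (p : Submodule k V) (hp) :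
    Function.Surjective (lin (quotProj V p hp)) :=
  p.mkQ_surjective

theorem exact_quotProj {V W : FinMod k A} (f : V ⟶ W) :
    Function.Exact (lin f) (lin (quotProj W _ (range_invariant f))) := fun _ =>
  Submodule.Quotient.mk_eq_zero _

theorem exact_subIncl_quotProj (V : FinMod k A) (p : Submodule k V) (hp) :
    Function.Exact (lin (subIncl V p hp)) (lin (quotProj V p hp)) := fun v =>
  (Submodule.Quotient.mk_eq_zero _).trans
    ⟨fun hv => ⟨⟨v, hv⟩, rfl⟩, by rintro ⟨v, rfl⟩; exact v.2⟩

theorem comp_quotProj {V W : FinMod k A} (f : V ⟶ W) :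
    f ≫ quotProj W _ (range_invariant f) = 0 :=
  (comp_eq_zero_iff _ _).2 (exact_quotProj f).apply_apply_eq_zero

instance : HasKernels (FinMod k A) where
  has_limit f := ⟨⟨_, isLimitOfExact _ f (subIncl_comp f) (subIncl_injective _ _ _)
    (exact_subIncl f)⟩⟩

instance : HasCokernels (FinMod k A) where
  has_colimit f := ⟨⟨_, isColimitOfExact f _ (comp_quotProj f) (quotProj_surjective _ _ _)
    (exact_quotProj f)⟩⟩

instance : IsNormalMonoCategory (FinMod k A) where
  normalMonoOfMono f _ := ⟨⟨_, _, comp_quotProj f,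
    isLimitOfExact f _ (comp_quotProj f) (injective_of_mono f) (exact_quotProj f)⟩⟩

instance : IsNormalEpiCategory (FinMod k A) where
  normalEpiOfEpi f _ := ⟨⟨_, _, subIncl_comp f,
    isColimitOfExact _ f (subIncl_comp f) (surjective_of_epi f) (exact_subIncl f)⟩⟩

theorem isZero_iff (V : FinMod k A) : IsZero V ↔ Subsingleton V := by
  rw [IsZero.iff_id_eq_zero]
  refine ⟨fun h => ⟨fun v w => ?_⟩, fun h => hom_ext (LinearMap.ext fun v => h.elim _ _)⟩
  have h0 : ∀ x : V, x = 0 := fun x => LinearMap.congr_fun (congrArg lin h) x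
  rw [h0 v, h0 w]

instance : HasZeroObject (FinMod k A) :=
  ⟨⟨zero, (isZero_iff _).2 (inferInstanceAs (Subsingleton PUnit))⟩⟩

/-- The direct sum of two modules. -/
def prod (V W : FinMod k A) : FinMod k A where
  carrier := V × W
  ρ :=
    { toFun := fun a => (V.ρ a).prodMap (W.ρ a)
      map_one' := by ext <;> simp
      map_mul' := fun a b => by ext <;> simp
      map_zero' := by ext <;> simp
      map_add' := fun a b => by ext <;> simp
      commutes' := fun r => by ext <;> simp }

instance : HasBinaryProducts (FinMod k A) := by
  have (V W : FinMod k A) : HasLimit (pair V W) :=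
    ⟨⟨BinaryFan.mk (P := prod V W) (ofLin (V := prod V W) (LinearMap.fst k V W) fun _ _ => rfl)
        (ofLin (V := prod V W) (LinearMap.snd k V W) fun _ _ => rfl),
      BinaryFan.IsLimit.mk _
        (fun {T} f g => ofLin (W := prod V W) ((lin f).prod (lin g)) fun a v =>
          Prod.ext (lin_comm f a v) (lin_comm g a v))
        (fun _ _ => rfl) (fun _ _ => rfl)
        (fun f g m hm₁ hm₂ => hom_ext <| LinearMap.ext fun v => Prod.ext
          (LinearMap.congr_fun (congrArg lin hm₁) v) (LinearMap.congr_fun (congrArg lin hm₂) v))⟩⟩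
  exact hasBinaryProducts_of_hasLimit_pair _

instance : HasFiniteProducts (FinMod k A) :=
  hasFiniteProducts_of_has_binary_and_terminal

noncomputable instance : Abelian (FinMod k A) where

theorem finite_hom (V W : FinMod k A) : Module.Finite k (V ⟶ W) :=
  inferInstanceAs (Module.Finite k (hom V W))

theorem finiteDimensionalOrder_subobject (V : FinMod k A) :
    FiniteDimensionalOrder (Subobject V) := by
  have hmono : StrictMono fun P : Subobject V => LinearMap.range (lin P.arrow) := by
    intro P Q hPQ
    refine lt_of_le_of_ne ?_ fun h => hPQ.not_ge ?_
    · rintro _ ⟨x, rfl⟩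
      refine ⟨lin (Subobject.ofLE P Q hPQ.le) x, ?_⟩
      rw [← LinearMap.comp_apply, ← lin_comp, Subobject.ofLE_arrow]
    · have hw : Q.arrow ≫ quotProj V _ (range_invariant P.arrow) = 0 :=
        (comp_eq_zero_iff _ _).2 fun x => (exact_quotProj P.arrow _).2 (by
          change _ ∈ LinearMap.range _
          rw [show LinearMap.range (lin P.arrow) = LinearMap.range (lin Q.arrow) from h]
          exact ⟨x, rfl⟩)
      refine Subobject.le_of_comm ((isLimitOfExact P.arrow _ (comp_quotProj P.arrow)
        (injective_of_mono _) (exact_quotProj P.arrow)).lift (KernelFork.ofι Q.arrow hw)) ?_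
      exact Fork.IsLimit.lift_ι _
  rw [Order.finiteDimensionalOrder_iff_krullDim_ne_bot_and_top]
  refine ⟨Order.krullDim_ne_bot_iff.2 inferInstance, ne_top_of_le_ne_top ?_
    (Order.krullDim_le_of_strictMono _ hmono)⟩
  exact (Order.finiteDimensionalOrder_iff_krullDim_ne_bot_and_top.1
    (inferInstance : FiniteDimensionalOrder (Submodule k V))).2

/-- The free module `A ⊗ V` over a finite-dimensional algebra `A`. -/
noncomputable def free (A : Type u) [Ring A] [Algebra k A] [Module.Finite k A] (V : Type u)
    [AddCommGroup V] [Module k V] [Module.Finite k V] : FinMod k A where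
  carrier := A ⊗[k] V
  ρ := (Module.End.rTensorAlgHom k A V).comp (Algebra.lmul k A)

section Free

variable [Module.Finite k A] {V : Type u} [AddCommGroup V] [Module k V] [Module.Finite k V]

/-- The inclusion `v ↦ 1 ⊗ v` of the generators of a free module. -/
noncomputable def freeι (A : Type u) [Ring A] [Algebra k A] [Module.Finite k A] (V : Type u)
    [AddCommGroup V] [Module k V] [Module.Finite k V] : V →ₗ[k] free (k := k) A V :=
  TensorProduct.mk k A V 1

theorem free_ρ_ι (a : A) (v : V) :
    (free (k := k) A V).ρ a (freeι A V v) = (a ⊗ₜ[k] v : A ⊗[k] V) :=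
  congrArg (· ⊗ₜ[k] v) (mul_one a)

/-- The morphism from a free module that extends a linear map. -/
noncomputable def freeLift {W : FinMod k A} (f : V →ₗ[k] W) : free A V ⟶ W :=
  ofLin (V := free A V) (TensorProduct.lift (LinearMap.lcomp k W f ∘ₗ W.ρ.toLinearMap))
    fun a x => by
      have h : ∀ x : A ⊗[k] V, TensorProduct.lift (LinearMap.lcomp k W f ∘ₗ W.ρ.toLinearMap)
          (LinearMap.rTensor V (LinearMap.mul k A a) x) =
          W.ρ a (TensorProduct.lift (LinearMap.lcomp k W f ∘ₗ W.ρ.toLinearMap) x) := fun x => by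
        induction x with
        | zero => simp
        | add x y hx hy => simp only [map_add, hx, hy]
        | tmul b v => simp
      exact h x

theorem freeLift_ι {W : FinMod k A} (f : V →ₗ[k] W) (v : V) :
    lin (freeLift f) (freeι A V v) = f v :=
  (congrArg (fun t : Module.End k W => t (f v)) (map_one W.ρ) : _)

theorem free_hom_ext {W : FinMod k A} {f g : free A V ⟶ W}
    (h : ∀ v : V, lin f (freeι A V v) = lin g (freeι A V v)) : f = g := by
  refine hom_ext (TensorProduct.ext' fun a v => ?_)
  have h1 := lin_comm f a (freeι A V v)
  have h2 := lin_comm g a (freeι A V v)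
  rw [free_ρ_ι] at h1 h2
  exact h1.trans ((congrArg _ (h v)).trans h2.symm)

variable (A V) in
theorem projective_free : Projective (free (k := k) A V) where
  factors {E X} f e _ := by
    obtain ⟨s, hs⟩ := (lin e).exists_rightInverse_of_surjective
      (LinearMap.range_eq_top.2 (surjective_of_epi e))
    refine ⟨freeLift (s ∘ₗ lin f ∘ₗ freeι A V), free_hom_ext fun v => ?_⟩
    rw [lin_comp, LinearMap.comp_apply, freeLift_ι]
    exact LinearMap.congr_fun hs _

theorem freeLift_id_surjective (W : FinMod k A) :
    Function.Surjective (lin (freeLift (LinearMap.id : W →ₗ[k] W))) := fun w =>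
  ⟨freeι A W w, freeLift_ι _ _⟩

theorem enoughProjectives : EnoughProjectives (FinMod k A) where
  presentation W := ⟨
    { p := free A W
      projective := projective_free A W
      f := freeLift LinearMap.id
      epi := epi_of_surjective _ (freeLift_id_surjective W) }⟩

end Free

end AbelianStructure

end FinMod

/-! ### Simple modules -/

namespace FinMod

section Simples

variable {k A : Type u} [Field k] [Ring A] [Algebra k A]

theorem simple_iff (V : FinMod k A) : Simple V ↔ Nontrivial V ∧
    ∀ p : Submodule k V, (∀ a, ∀ v ∈ p, V.ρ a v ∈ p) → p = ⊥ ∨ p = ⊤ := by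
  constructor
  · intro h
    refine ⟨not_subsingleton_iff_nontrivial.1 fun hs =>
      Simple.not_isZero V ((isZero_iff V).2 hs), fun p hp => ?_⟩
    have := mono_of_injective _ (subIncl_injective V p hp)
    by_cases h0 : subIncl V p hp = 0
    · refine Or.inl ((Submodule.eq_bot_iff _).2 fun v hv => ?_)
      exact LinearMap.congr_fun (congrArg lin h0) (⟨v, hv⟩ : p)
    · have := isIso_of_mono_of_nonzero h0
      refine Or.inr (eq_top_iff.2 fun v _ => ?_)
      obtain ⟨w, rfl⟩ := surjective_of_epi (subIncl V p hp) v
      exact w.2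
  · rintro ⟨hn, h⟩
    refine ⟨fun {Y} f _ => ⟨?_, fun h0 => ?_⟩⟩
    · rintro hf rfl
      obtain ⟨v, hv⟩ := exists_ne (0 : V)
      obtain ⟨w, rfl⟩ := surjective_of_epi (0 : Y ⟶ V) v
      exact hv rfl
    · refine isIso_of_bijective f ⟨injective_of_mono f, LinearMap.range_eq_top.1 ?_⟩
      refine (h _ (range_invariant f)).resolve_left fun hb => h0 ?_
      exact hom_ext (LinearMap.range_eq_bot.1 hb)

theorem nontrivial_of_simple (V : FinMod k A) [h : Simple V] : Nontrivial V :=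
  ((simple_iff V).1 h).1

/-- Dévissage: a property of finite-dimensional modules that holds for zero modules and for simple
modules, and that is inherited by extensions, holds for all of them. -/
theorem devissage {P : FinMod k A → Prop} (h0 : ∀ V : FinMod k A, Subsingleton V → P V)
    (h1 : ∀ V, Simple V → P V)
    (h2 : ∀ {X Y Z : FinMod k A} (f : X ⟶ Y) (g : Y ⟶ Z), Function.Injective (lin f) →
      Function.Exact (lin f) (lin g) → Function.Surjective (lin g) → P X → P Z → P Y)
    (V : FinMod k A) : P V := by
  induction hn : Module.finrank k V using Nat.strong_induction_on generalizing V with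
  | _ n ih =>
  rcases subsingleton_or_nontrivial V with h | h
  · exact h0 V h
  by_cases hs : Simple V
  · exact h1 V hs
  have : ∃ p : Submodule k V, (∀ a, ∀ v ∈ p, V.ρ a v ∈ p) ∧ p ≠ ⊥ ∧ p ≠ ⊤ := by
    by_contra hc
    push Not at hc
    exact hs ((simple_iff V).2 ⟨h, fun p hp => or_iff_not_imp_left.2 (hc p hp)⟩)
  obtain ⟨p, hp, hb, ht⟩ := this
  have e1 := Submodule.finrank_lt ht
  have e2 := p.finrank_quotient_add_finrank
  have := Submodule.nontrivial_iff_ne_bot.2 hb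
  have e3 : 0 < Module.finrank k p := Module.finrank_pos
  have hsub : P (sub V p hp) := ih (Module.finrank k p) (by omega) _ rfl
  have hquot : P (quot V p hp) := ih (Module.finrank k (V ⧸ p)) (by omega) _ rfl
  exact h2 (subIncl V p hp) (quotProj V p hp) (subIncl_injective _ _ _)
    (exact_subIncl_quotProj V p hp) (quotProj_surjective _ _ _) hsub hquot

section Density

/-- The structure of a module over `A` in the sense of Mathlib. -/
@[reducible]
def toModule (V : FinMod k A) : Module A V := Module.compHom V V.ρ.toRingHom

attribute [local instance] toModule

theorem smul_eq_ρ (V : FinMod k A) (a : A) (v : V) : a • v = V.ρ a v := rfl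

/-- A morphism as an `A`-linear map. -/
def linA {V W : FinMod k A} (f : V →ₗ[A] W) : V ⟶ W :=
  ofLin
    { toFun := f
      map_add' := map_add f
      map_smul' := fun r v => by
        have h := f.map_smul (algebraMap k A r) v
        simpa [smul_eq_ρ] using h } f.map_smul

theorem isSimpleModule_of_simple (V : FinMod k A) [h : Simple V] : IsSimpleModule A V := by
  have := nontrivial_of_simple V
  refine { exists_pair_ne := ⟨⊥, ⊤, bot_ne_top⟩, eq_bot_or_eq_top := fun p => ?_ }
  let q : Submodule k V :=
    { p.toAddSubmonoid with
      smul_mem' := fun r v hv => by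
        have h := p.smul_mem (algebraMap k A r) hv
        rwa [smul_eq_ρ, AlgHom.commutes, Module.algebraMap_end_apply] at h }
  have hmem : ∀ v, v ∈ q ↔ v ∈ p := fun v => Iff.rfl
  rcases ((simple_iff V).1 h).2 q fun a v hv => p.smul_mem a hv with hq | hq
  · exact Or.inl ((Submodule.eq_bot_iff _).2 fun v hv =>
      (Submodule.eq_bot_iff _).1 hq v ((hmem v).2 hv))
  · exact Or.inr (eq_top_iff.2 fun v _ => (hmem v).1 (hq ▸ Submodule.mem_top))

/-- Elements of `A` separate pairwise non-isomorphic simple modules: this is the density theorem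
for the direct sum of the modules, whose projections commute with all endomorphisms by Schur's
lemma. -/
theorem exists_separating {ι : Type*} [Finite ι] [DecidableEq ι] (S : ι → FinMod k A)
    [∀ i, Simple (S i)] (hne : ∀ i j, Nonempty (S i ≅ S j) → i = j) (i : ι) :
    ∃ r : A, ∀ j, (S j).ρ r = if j = i then 1 else 0 := by
  have := Fintype.ofFinite ι
  have := fun i => isSimpleModule_of_simple (S i)
  have hschur : ∀ j l, j ≠ l → ∀ f : S j →ₗ[A] S l, f = 0 := by
    intro j l hjl f
    by_contra hf
    have h0 : linA f ≠ 0 := fun h => hf (LinearMap.ext fun v =>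
      LinearMap.congr_fun (congrArg lin h) v)
    have := isIso_of_hom_simple h0
    exact hjl (hne j l ⟨asIso (linA f)⟩)
  have hproj : ∀ (g : Module.End A (∀ j, S j)) (m : ∀ j, S j),
      g (Pi.single i (m i)) = Pi.single i (g m i) := by
    intro g m
    ext l
    by_cases hl : l = i
    · subst hl
      rw [Pi.single_eq_same]
      conv_rhs => rw [← Finset.univ_sum_single m]
      rw [map_sum, Finset.sum_apply, Finset.sum_eq_single_of_mem l (Finset.mem_univ l)]
      intro j _ hj
      exact LinearMap.congr_fun (hschur j l hj
        (LinearMap.proj l ∘ₗ g ∘ₗ LinearMap.single A (fun j => (S j : Type u)) j)) (m j)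
    · rw [Pi.single_eq_of_ne hl]
      exact LinearMap.congr_fun (hschur i l (Ne.symm hl)
        (LinearMap.proj l ∘ₗ g ∘ₗ LinearMap.single A (fun j => (S j : Type u)) i)) (m i)
  let p : Module.End (Module.End A (∀ j, S j)) (∀ j, S j) :=
    { toFun := fun m => Pi.single i (m i)
      map_add' := fun m n => by rw [Pi.add_apply, Pi.single_add]
      map_smul' := fun g m => (hproj g m).symm }
  obtain ⟨s, hs⟩ := (Module.Finite.fg_top : (⊤ : Submodule k (∀ j, S j)).FG)
  obtain ⟨r, hr⟩ := jacobson_density p s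
  have key : ∀ m : ∀ j, S j, Pi.single i (m i) = fun j => (S j).ρ r (m j) := by
    intro m
    have hm : m ∈ Submodule.span k (s : Set (∀ j, S j)) := hs ▸ Submodule.mem_top
    induction hm using Submodule.span_induction with
    | mem m hm => exact hr m hm
    | zero => ext j; simp
    | add m n _ _ hm hn =>
      rw [Pi.add_apply, Pi.single_add, hm, hn]
      ext j
      simp
    | smul c m _ hm =>
      rw [Pi.smul_apply, Pi.single_smul, hm]
      ext j
      simp
  refine ⟨r, fun j => LinearMap.ext fun v => ?_⟩
  have h := congrFun (key (Pi.single j v)) j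
  simp only [Pi.single_eq_same] at h
  rw [← h]
  by_cases hj : j = i
  · subst hj
    simp
  · rw [Pi.single_eq_of_ne hj, if_neg hj]
    rfl

end Density

/-- A representative of an isomorphism class of simple modules. -/
noncomputable def rep (S : Irr (FinMod k A)) : FinMod k A := (Quotient.out S).1

instance (S : Irr (FinMod k A)) : Simple (rep S) := (Quotient.out S).2

theorem rep_injective (S T : Irr (FinMod k A)) (h : Nonempty (rep S ≅ rep T)) : S = T := by
  rw [← Quotient.out_eq S, ← Quotient.out_eq T]
  exact Quotient.sound h

theorem exists_rep_iso (V : FinMod k A) [h : Simple V] :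
    ∃ S : Irr (FinMod k A), Nonempty (rep S ≅ V) :=
  ⟨Quotient.mk _ ⟨V, h⟩, Quotient.mk_out (s := simpleSetoid (FinMod k A)) ⟨V, h⟩⟩

theorem _root_.Gr.irr_eq_cls_rep (S : Irr (FinMod k A)) : Gr.irr S = Gr.cls (rep S) := by
  conv_lhs => rw [← Quotient.out_eq S]
  rfl

theorem card_le_finrank [Module.Finite k A] (s : Finset (Irr (FinMod k A))) :
    s.card ≤ Module.finrank k A := by
  classical
  choose r hr using exists_separating (fun S : s => rep S.1)
    fun S T h => Subtype.ext (rep_injective _ _ h)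
  have hli : LinearIndependent k r := by
    refine linearIndependent_iff'.2 fun t g hg i hi => ?_
    have := nontrivial_of_simple (rep i.1)
    obtain ⟨v, hv⟩ := exists_ne (0 : rep i.1)
    have h := congrArg (fun a => (rep i.1).ρ a v) hg
    simp only [map_sum, map_smul, LinearMap.sum_apply, LinearMap.smul_apply, map_zero,
      LinearMap.zero_apply, hr] at h
    rw [Finset.sum_eq_single_of_mem i hi] at h
    · rw [if_pos rfl, Module.End.one_apply] at h
      exact (smul_eq_zero.1 h).resolve_right hv
    · intro j _ hj
      rw [if_neg hj.symm, LinearMap.zero_apply, smul_zero]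
  simpa using hli.fintype_card_le_finrank

instance finite_irr [Module.Finite k A] : Finite (Irr (FinMod k A)) := by
  by_contra h
  rw [not_finite_iff_infinite] at h
  obtain ⟨s, hs⟩ := Infinite.exists_subset_card_eq (Irr (FinMod k A)) (Module.finrank k A + 1)
  have := card_le_finrank s
  omega

theorem isFiniteAbelian [Module.Finite k A] : IsFiniteAbelian k (FinMod k A) where
  hasFiniteProducts := inferInstance
  hasKernels := inferInstance
  hasCokernels := inferInstance
  normalMono := inferInstance
  normalEpi := inferInstance
  finite_hom := finite_hom
  finite_length := finiteDimensionalOrder_subobject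
  enoughProjectives := enoughProjectives
  finite_irr := finite_irr

/-! ### The basis of simple modules of the Grothendieck group -/

/-- An element that annihilates all simple modules acts nilpotently on all modules. -/
theorem isNilpotent_of_annihilates_simples (a : A) (ha : ∀ V : FinMod k A, Simple V → V.ρ a = 0)
    (V : FinMod k A) : IsNilpotent (V.ρ a) := by
  refine devissage (P := fun V => IsNilpotent (V.ρ a)) (fun V _ => ⟨1, LinearMap.ext fun v =>
    Subsingleton.elim _ _⟩) (fun V hV => ⟨1, by rw [ha V hV, pow_one]⟩) ?_ V
  rintro X Y Z f g hf hfg hg ⟨m, hm⟩ ⟨n, hn⟩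
  refine ⟨m + n, LinearMap.ext fun y => ?_⟩
  rw [← map_pow] at *
  have h1 : lin g (Y.ρ (a ^ n) y) = 0 := by rw [lin_comm, hn]; rfl
  obtain ⟨x, hx⟩ := (hfg _).1 h1
  rw [pow_add, map_mul, Module.End.mul_apply, ← hx, ← lin_comm, hm]
  exact map_zero _

/-- For each simple module `T` there is an idempotent that acts as the identity on `T` and as zero
on the other simple modules: an element `r` that acts in this way satisfies `r - r ^ 2` nilpotent,
and idempotents lift along nilpotents. -/
theorem exists_idempotent [Module.Finite k A] [DecidableEq (Irr (FinMod k A))]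
    (T : Irr (FinMod k A)) :
    ∃ e : A, IsIdempotentElem e ∧ ∀ S, (rep S).ρ e = if S = T then 1 else 0 := by
  obtain ⟨r, hr⟩ := exists_separating (rep (k := k) (A := A)) rep_injective T
  have hnil : IsNilpotent (r - r ^ 2) := by
    have h := isNilpotent_of_annihilates_simples (r - r ^ 2) (fun V hV => ?_)
      (free (k := k) A k)
    · obtain ⟨n, hn⟩ := h
      refine ⟨n, ?_⟩
      have h1 := LinearMap.congr_fun hn (freeι A k 1)
      rw [← map_pow, free_ρ_ι] at h1
      have h2 : ((r - r ^ 2) ^ n) ⊗ₜ[k] (1 : k) = 0 := h1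
      simpa using congrArg (TensorProduct.rid k A) h2
    · obtain ⟨S, ⟨e⟩⟩ := exists_rep_iso V
      refine LinearMap.ext fun v => ?_
      have hv : lin e.hom (lin e.inv v) = v := by
        rw [← LinearMap.comp_apply, ← lin_comp, e.inv_hom_id]; rfl
      rw [← hv, ← lin_comm, map_sub, map_pow, hr]
      split_ifs <;> simp
  obtain ⟨n, hn⟩ := hnil
  have hn' : (r - r ^ 2) ^ (n + 1) = 0 := by rw [pow_succ, hn, zero_mul]
  refine ⟨_, isIdempotentElem_one_sub_one_sub_pow_pow r (n + 1) hn', fun S => ?_⟩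
  rw [map_sub, map_pow, map_sub, map_pow, map_one, hr]
  split_ifs <;> simp

theorem finrank_range_idempotent {e : A} (he : IsIdempotentElem e) {X Y Z : FinMod k A}
    (f : X ⟶ Y) (g : Y ⟶ Z) (hf : Function.Injective (lin f))
    (hfg : Function.Exact (lin f) (lin g)) (hg : Function.Surjective (lin g)) :
    Module.finrank k (LinearMap.range (Y.ρ e)) =
      Module.finrank k (LinearMap.range (X.ρ e)) + Module.finrank k (LinearMap.range (Z.ρ e)) := by
  have hidem : ∀ (V : FinMod k A) (v : V), V.ρ e (V.ρ e v) = V.ρ e v := fun V v => by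
    rw [← Module.End.mul_apply, ← map_mul, he.eq]
  have h1 := ((lin g).domRestrict (LinearMap.range (Y.ρ e))).finrank_range_add_finrank_ker
  have h2 : LinearMap.range ((lin g).domRestrict (LinearMap.range (Y.ρ e))) =
      LinearMap.range (Z.ρ e) := by
    ext z
    constructor
    · rintro ⟨⟨_, ⟨y, rfl⟩⟩, rfl⟩
      exact ⟨lin g y, (lin_comm g e y).symm⟩
    · rintro ⟨z, rfl⟩
      obtain ⟨y, rfl⟩ := hg z
      exact ⟨⟨_, ⟨y, rfl⟩⟩, lin_comm g e y⟩
  let ψ : LinearMap.range (X.ρ e) →ₗ[k]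
      LinearMap.ker ((lin g).domRestrict (LinearMap.range (Y.ρ e))) :=
    { toFun := fun x => ⟨⟨lin f x.1, by
          obtain ⟨_, ⟨x, rfl⟩⟩ := x
          exact ⟨lin f x, (lin_comm f e x).symm⟩⟩, hfg.apply_apply_eq_zero x.1⟩
      map_add' := fun x y => Subtype.ext (Subtype.ext (map_add (lin f) _ _))
      map_smul' := fun r x => Subtype.ext (Subtype.ext (map_smul (lin f) _ _)) }
  have hψ : Function.Bijective ψ := by
    constructor
    · intro x y h
      exact Subtype.ext (hf (congrArg (fun t => t.1.1) h))
    · rintro ⟨⟨_, ⟨y, rfl⟩⟩, hy⟩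
      obtain ⟨x, hx⟩ := (hfg _).1 hy
      refine ⟨⟨X.ρ e x, ⟨x, rfl⟩⟩, Subtype.ext (Subtype.ext ?_)⟩
      exact (lin_comm f e x).trans ((congrArg (Y.ρ e) hx).trans (hidem Y y))
  rw [h2, ← (LinearEquiv.ofBijective ψ hψ).finrank_eq] at h1
  omega

end Simples

end FinMod

namespace Gr

open FinMod

variable {k A : Type u} [Field k] [Ring A] [Algebra k A]

/-- The dimension of `eX` for an idempotent `e`, as a homomorphism on the Grothendieck group. -/
noncomputable def rankHom {e : A} (he : IsIdempotentElem e) : Gr k A →+ ℤ :=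
  lift (fun X => (Module.finrank k (LinearMap.range (X.ρ e)) : ℤ)) fun f g hf hfg hg => by
    rw [finrank_range_idempotent he f g hf hfg hg, Nat.cast_add]

theorem rankHom_cls {e : A} (he : IsIdempotentElem e) (X : FinMod k A) :
    rankHom he (cls X) = Module.finrank k (LinearMap.range (X.ρ e)) :=
  lift_cls _ _ X

theorem cls_of_subsingleton (X : FinMod k A) (h : Subsingleton X) : cls X = 0 := by
  have h1 := cls_add (𝟙 X) (𝟙 X) (fun _ _ h => h)
    (fun x => ⟨fun _ => ⟨x, rfl⟩, fun _ => Subsingleton.elim _ _⟩) (fun x => ⟨x, rfl⟩)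
  exact left_eq_add.1 h1

theorem cls_mem_span_irr (X : FinMod k A) :
    cls X ∈ Submodule.span ℤ (Set.range (irr (k := k) (A := A))) := by
  refine devissage (P := fun X => cls X ∈ Submodule.span ℤ (Set.range (irr (k := k) (A := A))))
    (fun V h => ?_) (fun V h => ?_) (fun f g hf hfg hg hX hZ => ?_) X
  · rw [cls_of_subsingleton V h]
    exact zero_mem _
  · exact Submodule.subset_span ⟨Quotient.mk _ ⟨V, h⟩, rfl⟩
  · rw [cls_add f g hf hfg hg]
    exact add_mem hX hZ

/-- The multiplicity of a simple module, up to a positive factor: a homomorphism on the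
Grothendieck group that is nonnegative on classes of modules and vanishes on the classes of the
other simple modules. -/
theorem exists_multiplicity [Module.Finite k A] (T : Irr (FinMod k A)) :
    ∃ φ : Gr k A →+ ℤ, (∀ X : FinMod k A, 0 ≤ φ (cls X)) ∧ 0 < φ (irr T) ∧
      ∀ S, S ≠ T → φ (irr S) = 0 := by
  classical
  obtain ⟨e, he, h⟩ := exists_idempotent T
  refine ⟨rankHom he, fun X => ?_, ?_, fun S hS => ?_⟩
  · rw [rankHom_cls]
    exact Nat.cast_nonneg _
  · have := nontrivial_of_simple (rep T)
    rw [irr_eq_cls_rep, rankHom_cls, h, if_pos rfl, Module.End.one_eq_id, LinearMap.range_id,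
      finrank_top]
    exact_mod_cast Module.finrank_pos
  · rw [irr_eq_cls_rep, rankHom_cls, h, if_neg hS, LinearMap.range_zero, finrank_bot, Nat.cast_zero]

theorem linearIndependent_irr [Module.Finite k A] :
    LinearIndependent ℤ (irr (k := k) (A := A)) := by
  refine linearIndependent_iff'.2 fun s c hc T hT => ?_
  obtain ⟨φ, -, hT0, hφ⟩ := exists_multiplicity T
  have h := congrArg φ hc
  simp only [map_sum, map_zsmul, map_zero] at h
  rw [Finset.sum_eq_single_of_mem T hT fun S _ hS => by rw [hφ S hS, smul_zero]] at h
  exact (smul_eq_zero.1 h).resolve_right hT0.ne'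

/-- The basis of the Grothendieck group given by the simple modules. -/
noncomputable def irrBasis [Module.Finite k A] : Module.Basis (Irr (FinMod k A)) ℤ (Gr k A) :=
  Module.Basis.mk linearIndependent_irr fun x _ => by
    induction x using induction with
    | h0 => exact zero_mem _
    | h1 X => exact cls_mem_span_irr X
    | hneg x hx => exact neg_mem (hx trivial)
    | hadd x y hx hy => exact add_mem (hx trivial) (hy trivial)

theorem irrBasis_apply [Module.Finite k A] (S : Irr (FinMod k A)) : irrBasis S = irr S :=
  Module.Basis.mk_apply _ _ _

theorem multiplicity_eq [Module.Finite k A] (T : Irr (FinMod k A)) (φ : Gr k A →+ ℤ)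
    (hφ : ∀ S, S ≠ T → φ (irr S) = 0) (x : Gr k A) :
    φ x = irrBasis.repr x T * φ (irr T) := by
  have h : φ.toIntLinearMap =
      (irrBasis.coord T).smulRight (φ (irr T)) := by
    refine irrBasis.ext fun S => ?_
    rw [AddMonoidHom.coe_toIntLinearMap, irrBasis_apply, LinearMap.smulRight_apply,
      Module.Basis.coord_apply, ← irrBasis_apply, Module.Basis.repr_self, irrBasis_apply]
    by_cases hS : S = T
    · subst hS; simp
    · rw [hφ S hS, Finsupp.single_eq_of_ne (Ne.symm hS), zero_smul]
  exact LinearMap.congr_fun h x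

theorem repr_cls_nonneg [Module.Finite k A] (X : FinMod k A) (T : Irr (FinMod k A)) :
    0 ≤ irrBasis.repr (cls X) T := by
  obtain ⟨φ, h1, h2, h3⟩ := exists_multiplicity T
  have h := h1 X
  rw [multiplicity_eq T φ h3] at h
  exact nonneg_of_mul_nonneg_left h h2

/-- A simple quotient of a module occurs in it with positive multiplicity. -/
theorem repr_cls_pos [Module.Finite k A] (X : FinMod k A) (T : Irr (FinMod k A))
    (f : X ⟶ rep T) (hf : f ≠ 0) : 0 < irrBasis.repr (cls X) T := by
  have := epi_of_nonzero_to_simple hf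
  rw [cls_add (subIncl X _ (ker_invariant f)) f (subIncl_injective _ _ _) (exact_subIncl f)
    (surjective_of_epi f), ← irr_eq_cls_rep, ← irrBasis_apply, map_add, Finsupp.add_apply,
    Module.Basis.repr_self, Finsupp.single_eq_same]
  have := repr_cls_nonneg (sub X _ (ker_invariant f)) T
  omega

end Gr

/-! ### Galois objects -/

namespace FinMod

open LeftComoduleAlgebra

section Galois

variable {k A D : Type u} [Field k] [Ring A] [Bialgebra k A] [Ring D] [Algebra k D]

/-- For a linear map `φ : X → Y ⊗ D`, the map `X ⊗ D → Y ⊗ D`, `x ⊗ d ↦ φ(x)(1 ⊗ d)`. -/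
noncomputable def extendRight {X Y : Type u} [AddCommGroup X] [Module k X] [AddCommGroup Y]
    [Module k Y] (φ : X →ₗ[k] Y ⊗[k] D) : X ⊗[k] D →ₗ[k] Y ⊗[k] D :=
  LinearMap.lTensor Y (LinearMap.mul' k D) ∘ₗ (TensorProduct.assoc k Y D D).toLinearMap ∘ₗ
    LinearMap.rTensor D φ

variable (k A D) in
/-- A left `A`-comodule algebra `D` is a (left) Galois object over `A` if the canonical map
`D ⊗ D → A ⊗ D`, `x ⊗ y ↦ x₍₋₁₎ ⊗ x₍₀₎ y`, is bijective. Here this is expressed through the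
translation map `τ`, the restriction of the inverse of the canonical map to `A ⊗ 1`. -/
def IsGalois [LeftComoduleAlgebra k A D] : Prop :=
  ∃ τ : A →ₗ[k] D ⊗[k] D,
    (∀ d : D, extendRight τ (coact (k := k) (A := A) d) = d ⊗ₜ 1) ∧
    ∀ a : A, extendRight (coact (k := k) (A := A) (D := D)).toLinearMap (τ a) = a ⊗ₜ 1

/-- The map `Y ⊗ D → Y ⊗ W`, `y ⊗ d ↦ y ⊗ dw`. -/
noncomputable def evalRight (Y : Type u) [AddCommGroup Y] [Module k Y] (W : FinMod k D) (w : W) :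
    Y ⊗[k] D →ₗ[k] Y ⊗[k] W :=
  LinearMap.lTensor Y (W.ρ.toLinearMap.flip w)

theorem evalRight_tmul {Y : Type u} [AddCommGroup Y] [Module k Y] (W : FinMod k D) (w : W) (y : Y)
    (d : D) : evalRight Y W w (y ⊗ₜ d) = y ⊗ₜ W.ρ d w := rfl

/-- For a linear map `φ : X → Y ⊗ D`, the map `X ⊗ W → Y ⊗ W`, `x ⊗ w ↦ φ(x)(1 ⊗ w)`. -/
noncomputable def extendTo {X Y : Type u} [AddCommGroup X] [Module k X] [AddCommGroup Y]
    [Module k Y] (φ : X →ₗ[k] Y ⊗[k] D) (W : FinMod k D) : X ⊗[k] W →ₗ[k] Y ⊗[k] W :=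
  LinearMap.lTensor Y (TensorProduct.lift W.ρ.toLinearMap) ∘ₗ
    (TensorProduct.assoc k Y D W).toLinearMap ∘ₗ LinearMap.rTensor W φ

theorem extendTo_tmul {X Y : Type u} [AddCommGroup X] [Module k X] [AddCommGroup Y]
    [Module k Y] (φ : X →ₗ[k] Y ⊗[k] D) (W : FinMod k D) (x : X) (w : W) :
    extendTo φ W (x ⊗ₜ w) = evalRight Y W w (φ x) := by
  change LinearMap.lTensor Y (TensorProduct.lift W.ρ.toLinearMap)
    (TensorProduct.assoc k Y D W (φ x ⊗ₜ w)) = _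
  induction φ x with
  | zero => simp
  | add s t hs ht => rw [TensorProduct.add_tmul, map_add, map_add, map_add, hs, ht]
  | tmul y d => rfl

theorem extendTo_evalRight {X Y : Type u} [AddCommGroup X] [Module k X] [AddCommGroup Y]
    [Module k Y] (φ : X →ₗ[k] Y ⊗[k] D) (W : FinMod k D) (w : W) (t : X ⊗[k] D) :
    extendTo φ W (evalRight X W w t) = evalRight Y W w (extendRight φ t) := by
  induction t with
  | zero => simp
  | add s t hs ht => simp only [map_add, hs, ht]
  | tmul x d =>
    rw [evalRight_tmul, extendTo_tmul]
    change _ = evalRight Y W w (LinearMap.lTensor Y (LinearMap.mul' k D)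
      (TensorProduct.assoc k Y D D (φ x ⊗ₜ d)))
    induction φ x with
    | zero => simp
    | add s t hs ht => rw [TensorProduct.add_tmul, map_add, map_add, map_add, map_add, hs, ht]
    | tmul y d' =>
      rw [evalRight_tmul, TensorProduct.assoc_tmul, LinearMap.lTensor_tmul, evalRight_tmul,
        LinearMap.mul'_apply, map_mul, Module.End.mul_apply]

theorem assoc_outer_rTensor {U V W : Type u} [AddCommGroup U] [Module k U] [AddCommGroup V]
    [Module k V] [AddCommGroup W] [Module k W] (ρ : A →ₐ[k] Module.End k U)
    (σ : D →ₐ[k] Module.End k W) (t : A ⊗[k] D) (x : (U ⊗[k] V) ⊗[k] W) :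
    TensorProduct.assoc k U V W (outer ((Module.End.rTensorAlgHom k U V).comp ρ) σ t x) =
      outer ρ ((Module.End.lTensorAlgHom k W V).comp σ) t (TensorProduct.assoc k U V W x) := by
  induction t with
  | zero => simp
  | add s t hs ht => simp only [map_add, LinearMap.add_apply, hs, ht]
  | tmul a d =>
    induction x with
    | zero => simp
    | add x y hx hy => simp only [map_add, hx, hy]
    | tmul y w =>
      induction y with
      | zero => simp
      | add x y hx hy => simp only [TensorProduct.add_tmul, map_add, hx, hy]
      | tmul b v => rfl

/-- The regular module. -/
def regular (k A : Type u) [Field k] [Ring A] [Algebra k A] [Module.Finite k A] : FinMod k A where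
  carrier := A
  ρ := Algebra.lmul k A

variable [LeftComoduleAlgebra k A D] [Module.Finite k A]

theorem act_regular_ρ (W : FinMod k D) (d : D) (w : W) :
    (act (regular k A) W).ρ d ((1 : A) ⊗ₜ w) = evalRight A W w (coact (k := k) (A := A) d) := by
  change outer (Algebra.lmul k A) W.ρ (coact (k := k) (A := A) d) ((1 : A) ⊗ₜ w) = _
  induction coact (k := k) (A := A) d with
  | zero => simp
  | add s t hs ht => simp only [map_add, LinearMap.add_apply, hs, ht]
  | tmul a d =>
    change (a * 1) ⊗ₜ W.ρ d w = _
    rw [mul_one, evalRight_tmul]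

variable [Module.Finite k D]

theorem freeLift_regular (W : FinMod k D) (x : D ⊗[k] W) :
    lin (freeLift (A := D) (W := act (regular k A) W) (TensorProduct.mk k A W 1)) x =
      extendTo (coact (k := k) (A := A) (D := D)).toLinearMap W x := by
  induction x with
  | zero => exact (map_zero _).trans (map_zero _).symm
  | add x y hx hy =>
    rw [map_add, ← hx, ← hy]
    exact map_add _ _ _
  | tmul d w =>
    exact (act_regular_ρ W d w).trans
      (extendTo_tmul (coact (k := k) (A := A) (D := D)).toLinearMap W d w).symm

/-- Over a Galois object, the tensor product of the regular module with any module is free. -/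
noncomputable def freeIsoActRegular (h : IsGalois k A D) (W : FinMod k D) :
    free D W ≅ act (regular k A) W :=
  isoOfBijective (freeLift (W := act (regular k A) W) (TensorProduct.mk k A W 1)) <| by
    obtain ⟨τ, h1, h2⟩ := h
    have e1 : ∀ x : D ⊗[k] W, extendTo τ W
        (extendTo (coact (k := k) (A := A) (D := D)).toLinearMap W x) = x := fun x => by
      induction x with
      | zero => simp
      | add x y hx hy => rw [map_add, map_add, hx, hy]
      | tmul d w =>
        rw [extendTo_tmul, extendTo_evalRight, AlgHom.toLinearMap_apply, h1, evalRight_tmul,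
          map_one, Module.End.one_apply]
    have e2 : ∀ x : A ⊗[k] W, extendTo (coact (k := k) (A := A) (D := D)).toLinearMap W
        (extendTo τ W x) = x := fun x => by
      induction x with
      | zero => simp
      | add x y hx hy => rw [map_add, map_add, hx, hy]
      | tmul d w =>
        rw [extendTo_tmul, extendTo_evalRight, h2, evalRight_tmul, map_one, Module.End.one_apply]
    refine ⟨fun x y hxy => ?_, fun y => ⟨extendTo τ W y, (freeLift_regular W _).trans (e2 y)⟩⟩
    exact (e1 x).symm.trans ((congrArg (extendTo τ W) ((freeLift_regular W x).symm.trans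
      (hxy.trans (freeLift_regular W y)))).trans (e1 y))

/-- The tensor product of a vector space and a module, with the action on the second factor. -/
noncomputable def multiple (V : Type u) [AddCommGroup V] [Module k V] [Module.Finite k V]
    (W : FinMod k D) : FinMod k D where
  carrier := V ⊗[k] W
  ρ := (Module.End.lTensorAlgHom k W V).comp W.ρ

/-- `(A ⊗ V) ⊗ W ≅ A ⊗ (V ⊗ W)`, where `V` carries no action. -/
noncomputable def actFreeIso (V : Type u) [AddCommGroup V] [Module k V] [Module.Finite k V]
    (W : FinMod k D) : act (free A V) W ≅ act (regular k A) (multiple V W) :=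
  isoOfLin (V := act (free A V) W) (W := act (regular k A) (multiple V W))
    (TensorProduct.assoc k A V W) fun d x =>
      assoc_outer_rTensor (Algebra.lmul k A) W.ρ (coact (k := k) (A := A) d) x

theorem projective_act_free (h : IsGalois k A D) (V : Type u) [AddCommGroup V] [Module k V]
    [Module.Finite k V] (W : FinMod k D) : Projective (act (free A V) W) :=
  Projective.of_iso ((freeIsoActRegular h (multiple V W)).trans (actFreeIso V W).symm)
    (projective_free D _)

open MonoidalLeftAction in
/-- The module category attached to a Galois object is exact. -/
theorem isExactModuleCategory (h : IsGalois k A D) :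
    IsExactModuleCategory (FinMod k A) (FinMod k D) := fun P M hP => by
  let p : free A P ⟶ P := freeLift LinearMap.id
  have : Epi p := epi_of_surjective p (freeLift_id_surjective P)
  let s := Projective.factorThru (𝟙 P) p
  have hs : s ≫ p = 𝟙 P := Projective.factorThru_comp _ _
  have : Projective (free (k := k) A P ⊙ₗ M) := projective_act_free h P M
  exact Retract.projective (Y := free (k := k) A P ⊙ₗ M)
    { i := s ⊵ₗ M
      r := p ⊵ₗ M
      retract := by rw [← comp_actionHomLeft, hs, id_actionHomLeft] }

theorem exists_ne_zero_act_regular (h : IsGalois k A D) (S T : FinMod k D) [Nontrivial S]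
    [Nontrivial T] : ∃ f : act (regular k A) S ⟶ T, f ≠ 0 := by
  obtain ⟨t, ht⟩ := exists_ne (0 : T)
  obtain ⟨s, hs⟩ := exists_ne (0 : S)
  obtain ⟨φ, hφ⟩ := Module.Projective.exists_dual_ne_zero k hs
  refine ⟨(freeIsoActRegular h S).inv ≫ freeLift (φ.smulRight t), fun h0 => ?_⟩
  rw [Preadditive.IsIso.comp_left_eq_zero] at h0
  have h1 : lin (freeLift (A := D) (φ.smulRight t)) (freeι D S s) = 0 := by rw [h0]; rfl
  rw [freeLift_ι, LinearMap.smulRight_apply] at h1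
  exact (smul_ne_zero hφ ht) h1

open MonoidalLeftAction in
/-- The module category attached to a Galois object is indecomposable: a decomposition would
provide nonzero modules `S` and `T` without nonzero morphisms from `A ⊗ S` to `T`. -/
theorem isIndecomposableModuleCategory (h : IsGalois k A D) :
    IsIndecomposableModuleCategory.{u, u, u + 1, u, u + 1, v₂, u₂} k (FinMod k A) (FinMod k D) := by
  intro 𝓜₁ 𝓜₂ _ _ _ _ _ _ _ _ hm₁ hm₂ ⟨X, hX⟩ ⟨Y, hY⟩
  obtain ⟨O₁, hO₁⟩ := HasZeroObject.zero (C := 𝓜₁)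
  obtain ⟨O₂, hO₂⟩ := HasZeroObject.zero (C := 𝓜₂)
  let := prodAction (FinMod k A) 𝓜₁ 𝓜₂
  refine fun F => ⟨fun hF => ?_⟩
  have hzero : ∀ Z : 𝓜₁ × 𝓜₂, IsZero (F.inverse.obj Z) → IsZero Z.1 ∧ IsZero Z.2 := by
    intro Z hZ
    have e : (𝟙 Z : Z ⟶ Z) = ((0, 0) : (Z.1 ⟶ Z.1) × (Z.2 ⟶ Z.2)) :=
      F.inverse.map_injective (hZ.eq_of_src _ _)
    exact ⟨(IsZero.iff_id_eq_zero _).2 (congrArg Prod.fst e),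
      (IsZero.iff_id_eq_zero _).2 (congrArg Prod.snd e)⟩
  let S := F.inverse.obj (X, O₂)
  let T := F.inverse.obj (O₁, Y)
  have hS : Nontrivial S := not_subsingleton_iff_nontrivial.1 fun hs =>
    hX (hzero _ ((isZero_iff _).2 hs)).1
  have hT : Nontrivial T := not_subsingleton_iff_nontrivial.1 fun hs =>
    hY (hzero _ ((isZero_iff _).2 hs)).2
  obtain ⟨f, hf⟩ := exists_ne_zero_act_regular h S T
  -- `F (A ⊗ S)` is isomorphic to `(A ⊗ X, A ⊗ 0)`, and `A ⊗ 0` is zero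
  let e₁ : F.functor.obj (regular k A ⊙ₗ S) ≅ regular k A ⊙ₗ ((X, O₂) : 𝓜₁ × 𝓜₂) :=
    (Functor.LeftLinear.μₗIso F.functor (regular k A) S).symm.trans
      (((curriedAction (FinMod k A) (𝓜₁ × 𝓜₂)).obj (regular k A)).mapIso
        (F.counitIso.app (X, O₂)))
  let e₂ : F.functor.obj T ≅ ((O₁, Y) : 𝓜₁ × 𝓜₂) := F.counitIso.app (O₁, Y)
  have hA0 : IsZero (regular k A ⊙ₗ O₂) := by
    have h0 : (𝟙 O₂) + 𝟙 O₂ = 𝟙 O₂ := hO₂.eq_of_src _ _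
    have h1 := hm₂.add_right (regular k A) (𝟙 O₂) (𝟙 O₂)
    rw [h0, actionHomRight_id] at h1
    exact (IsZero.iff_id_eq_zero _).2 (left_eq_add.1 h1)
  have hsub : ∀ g g' : regular k A ⊙ₗ ((X, O₂) : 𝓜₁ × 𝓜₂) ⟶ ((O₁, Y) : 𝓜₁ × 𝓜₂), g = g' :=
    fun g g' => Prod.ext (hO₁.eq_of_tgt g.1 g'.1) (hA0.eq_of_src g.2 g'.2)
  refine hf (F.functor.map_injective ?_)
  have := hsub (e₁.inv ≫ F.functor.map f ≫ e₂.hom) (e₁.inv ≫ F.functor.map 0 ≫ e₂.hom)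
  rwa [cancel_epi, cancel_mono] at this

/-- `Gr(D)` is an irreducible module over `Gr(A)` for a nonzero Galois object `D`: every simple
module `T` occurs in `A ⊗ S` for every simple module `S`. -/
theorem isIrreducibleZPlusModule [Nontrivial D] (h : IsGalois k A D) :
    IsIrreducibleZPlusModule (Gr.irrBasis (k := k) (A := A)) (Gr.irrBasis (k := k) (A := D)) where
  isZPlusModule i l l' := by
    rw [Gr.irrBasis_apply, Gr.irrBasis_apply, Gr.irr_eq_cls_rep, Gr.irr_eq_cls_rep]
    have e : Gr.cls (rep i) • Gr.cls (rep l) = Gr.cls (act (rep i) (rep l)) := Gr.actHom_cls _ _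
    rw [e]
    exact Gr.repr_cls_nonneg _ _
  nonempty := by
    by_contra hne
    rw [not_nonempty_iff] at hne
    have hs : ∀ V : FinMod k D, Subsingleton V := devissage (fun V h => h)
      (fun V hV => (hne.false (Quotient.mk _ ⟨V, hV⟩)).elim)
      (fun f g hf hfg hg hX hZ => ⟨fun y y' => by
        have h0 : ∀ z, lin f 0 = z := fun z => by
          obtain ⟨x, rfl⟩ := (hfg z).1 (Subsingleton.elim _ _)
          rw [Subsingleton.elim x 0]
        rw [← h0 y, ← h0 y']⟩)
    exact not_subsingleton D (hs (regular k D))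
  eq_empty_or_univ J hJ := by
    rcases J.eq_empty_or_nonempty with h0 | ⟨S, hS⟩
    · exact Or.inl h0
    refine Or.inr (Set.eq_univ_of_forall fun T => ?_)
    have := nontrivial_of_simple (rep S)
    have := nontrivial_of_simple (rep T)
    have h1 := hJ (Gr.cls (regular k A)) (Gr.irrBasis S)
      (Submodule.subset_span (Set.mem_image_of_mem _ hS))
    have e : Gr.cls (regular k A) • Gr.irrBasis S = Gr.cls (act (regular k A) (rep S)) := by
      rw [Gr.irrBasis_apply, Gr.irr_eq_cls_rep]
      exact Gr.actHom_cls _ _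
    rw [e, Module.Basis.mem_span_image] at h1
    obtain ⟨f, hf⟩ := exists_ne_zero_act_regular h (rep S) (rep T)
    exact h1 (Finsupp.mem_support_iff.2 (Gr.repr_cls_pos _ T f hf).ne')

end Galois

section ModuleCategory

variable {k A D : Type u} [Field k] [Ring A] [Bialgebra k A] [Ring D] [Algebra k D]
  [LeftComoduleAlgebra k A D]

open MonoidalLeftAction

theorem isModuleCategory : IsModuleCategory k (FinMod k A) (FinMod k D) where
  add_left f g M := hom_ext (TensorProduct.map_add_left (lin f) (lin g) LinearMap.id)
  smul_left r _ _ f M := hom_ext (TensorProduct.map_smul_left r (lin f) LinearMap.id)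
  add_right X _ _ f g := hom_ext (TensorProduct.map_add_right LinearMap.id (lin f) (lin g))
  smul_right r X _ _ f := hom_ext (TensorProduct.map_smul_right r LinearMap.id (lin f))
  preservesFiniteLimits M := by
    have : (actionRight (FinMod k A) M).PreservesZeroMorphisms :=
      ⟨fun X Y => hom_ext (TensorProduct.map_zero_left LinearMap.id)⟩
    have (X Y : FinMod k A) (f : X ⟶ Y) :
        PreservesLimit (parallelPair f 0) (actionRight (FinMod k A) M) := by
      refine preservesLimit_of_preserves_limit_cone (isLimitOfExact _ f (subIncl_comp f)
        (subIncl_injective _ _ _) (exact_subIncl f)) ?_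
      refine (KernelFork.isLimitMapConeEquiv _ _).symm ?_
      exact isLimitOfExact ((actionRight (FinMod k A) M).map (subIncl _ _ (ker_invariant f)))
        ((actionRight (FinMod k A) M).map f)
        (by rw [← Functor.map_comp, subIncl_comp, Functor.map_zero])
        (Module.Flat.rTensor_preserves_injective_linearMap (M := M) _ (subIncl_injective _ _ _))
        (Module.Flat.rTensor_exact M (exact_subIncl f))
    exact Functor.preservesFiniteLimits_of_preservesKernels _
  preservesFiniteColimits M := by
    have : (actionRight (FinMod k A) M).PreservesZeroMorphisms :=
      ⟨fun X Y => hom_ext (TensorProduct.map_zero_left LinearMap.id)⟩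
    have (X Y : FinMod k A) (f : X ⟶ Y) :
        PreservesColimit (parallelPair f 0) (actionRight (FinMod k A) M) := by
      refine preservesColimit_of_preserves_colimit_cocone (isColimitOfExact f _ (comp_quotProj f)
        (quotProj_surjective _ _ _) (exact_quotProj f)) ?_
      refine (CokernelCofork.isColimitMapCoconeEquiv _ _).symm ?_
      exact isColimitOfExact ((actionRight (FinMod k A) M).map f)
        ((actionRight (FinMod k A) M).map (quotProj _ _ (range_invariant f)))
        (by rw [← Functor.map_comp, comp_quotProj, Functor.map_zero])
        (LinearMap.rTensor_surjective M (quotProj_surjective _ _ _))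
        (rTensor_exact M (exact_quotProj f) (quotProj_surjective _ _ _))
    exact Functor.preservesFiniteColimits_of_preservesCokernels _

end ModuleCategory

end FinMod

/-! ### The translation map of a Hopf algebra -/

namespace FinMod

open LeftComoduleAlgebra

section Translation

variable {k : Type u} [Field k]

theorem extendRight_tmul {D X Y : Type u} [Ring D] [Algebra k D] [AddCommGroup X] [Module k X]
    [AddCommGroup Y] [Module k Y] (φ : X →ₗ[k] Y ⊗[k] D) (x : X) (d : D) :
    extendRight φ (x ⊗ₜ d) =
      LinearMap.lTensor Y (LinearMap.mul' k D) (TensorProduct.assoc k Y D D (φ x ⊗ₜ d)) := rfl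

theorem extendRight_naturality {D D' X X' Y Y' : Type u} [Ring D] [Algebra k D] [Ring D']
    [Algebra k D'] [AddCommGroup X] [Module k X] [AddCommGroup Y] [Module k Y] [AddCommGroup X']
    [Module k X'] [AddCommGroup Y'] [Module k Y'] (φ : X →ₗ[k] Y ⊗[k] D)
    (φ' : X' →ₗ[k] Y' ⊗[k] D') (f : X →ₗ[k] X') (g : Y →ₗ[k] Y') (q : D →ₐ[k] D')
    (h : ∀ x, φ' (f x) = TensorProduct.map g q.toLinearMap (φ x)) (t : X ⊗[k] D) :
    extendRight φ' (TensorProduct.map f q.toLinearMap t) =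
      TensorProduct.map g q.toLinearMap (extendRight φ t) := by
  induction t with
  | zero => simp
  | add s t hs ht => simp only [map_add, hs, ht]
  | tmul x d =>
    rw [TensorProduct.map_tmul, extendRight_tmul, extendRight_tmul, h]
    induction φ x with
    | zero => simp
    | add s t hs ht => simp only [map_add, TensorProduct.add_tmul, hs, ht]
    | tmul y d' => simp

variable {H : Type u} [Ring H] [HopfAlgebra k H]

variable (k H) in
/-- The map `h ↦ h₍₁₎ ⊗ S(h₍₂₎)` of a Hopf algebra. -/
noncomputable def translation : H →ₗ[k] H ⊗[k] H :=
  LinearMap.lTensor H (HopfAlgebra.antipode k) ∘ₗ Coalgebra.comul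

theorem extendRight_translation (h : H) :
    extendRight (translation k H) (Coalgebra.comul (R := k) h) = h ⊗ₜ 1 := by
  have h1 : ∀ t : H ⊗[k] H, extendRight (translation k H) t =
      LinearMap.lTensor H (LinearMap.mul' k H ∘ₗ LinearMap.rTensor H (HopfAlgebra.antipode k))
        (TensorProduct.assoc k H H H (LinearMap.rTensor H (Coalgebra.comul (R := k)) t)) := by
    intro t
    induction t with
    | zero => simp
    | add s t hs ht => simp only [map_add, hs, ht]
    | tmul a b =>
      rw [extendRight_tmul, translation, LinearMap.comp_apply, LinearMap.rTensor_tmul]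
      induction Coalgebra.comul (R := k) a with
      | zero => simp
      | add s t hs ht => simp only [map_add, TensorProduct.add_tmul, hs, ht]
      | tmul x y => simp
  rw [h1, Coalgebra.coassoc_apply, ← LinearMap.comp_apply, ← LinearMap.lTensor_comp,
    LinearMap.comp_assoc, HopfAlgebra.mul_antipode_rTensor_comul, LinearMap.lTensor_comp,
    LinearMap.comp_apply, Coalgebra.lTensor_counit_comul]
  simp

theorem extendRight_comul (h : H) :
    extendRight (Coalgebra.comul (R := k)) (translation k H h) = h ⊗ₜ 1 := by
  have h1 : ∀ t : H ⊗[k] H, extendRight (Coalgebra.comul (R := k))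
        (LinearMap.lTensor H (HopfAlgebra.antipode k) t) =
      LinearMap.lTensor H (LinearMap.mul' k H ∘ₗ LinearMap.lTensor H (HopfAlgebra.antipode k))
        (TensorProduct.assoc k H H H (LinearMap.rTensor H (Coalgebra.comul (R := k)) t)) := by
    intro t
    induction t with
    | zero => simp
    | add s t hs ht => simp only [map_add, hs, ht]
    | tmul a b =>
      rw [LinearMap.lTensor_tmul, extendRight_tmul, LinearMap.rTensor_tmul]
      induction Coalgebra.comul (R := k) a with
      | zero => simp
      | add s t hs ht => simp only [map_add, TensorProduct.add_tmul, hs, ht]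
      | tmul x y => simp
  rw [translation, LinearMap.comp_apply, h1, Coalgebra.coassoc_apply, ← LinearMap.comp_apply,
    ← LinearMap.lTensor_comp, LinearMap.comp_assoc, HopfAlgebra.mul_antipode_lTensor_comul,
    LinearMap.lTensor_comp, LinearMap.comp_apply, Coalgebra.lTensor_counit_comul]
  simp

variable (k H) in
/-- A Hopf algebra is a Galois object over itself. -/
theorem isGalois_self :
    letI := LeftComoduleAlgebra.self k H
    IsGalois k H H :=
  ⟨translation k H, extendRight_translation, extendRight_comul⟩

end Translation

/-! ### Duals -/

section Duals

attribute [local instance] LeftComoduleAlgebra.self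

variable {k A : Type u} [Field k] [Ring A]

/-- The dual of a representation with respect to an anti-endomorphism `s` of the algebra: `a` acts
on functionals by precomposition with `s a`. -/
def dualRep [Algebra k A] (s : A →ₗ[k] A) (s_one : s 1 = 1) (s_mul : ∀ a b, s (a * b) = s b * s a)
    {V : Type u} [AddCommGroup V] [Module k V] (ρ : A →ₐ[k] Module.End k V) :
    A →ₐ[k] Module.End k (Module.Dual k V) :=
  AlgHom.ofLinearMap (Module.Dual.transpose ∘ₗ ρ.toLinearMap ∘ₗ s)
    (by ext; simp [s_one, Module.Dual.transpose]) (fun a b => by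
      ext; simp [s_mul, Module.Dual.transpose])

/-- The dual of a module with respect to an anti-endomorphism of the algebra. -/
def dual [Algebra k A] (s : A →ₗ[k] A) (s_one : s 1 = 1) (s_mul : ∀ a b, s (a * b) = s b * s a)
    (V : FinMod k A) : FinMod k A where
  carrier := Module.Dual k V
  ρ := dualRep s s_one s_mul V.ρ

/-- The identification of `V ⊗ V*` with the endomorphisms of `V`. -/
noncomputable def tensorDualToEnd (V : Type u) [AddCommGroup V] [Module k V] :
    V ⊗[k] Module.Dual k V →ₗ[k] Module.End k V :=
  dualTensorHom k V V ∘ₗ (TensorProduct.comm k V (Module.Dual k V)).toLinearMap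

theorem tensorDualToEnd_tmul (V : Type u) [AddCommGroup V] [Module k V] (v : V)
    (f : Module.Dual k V) (w : V) : tensorDualToEnd V (v ⊗ₜ f) w = f w • v := rfl

theorem tensorDualToEnd_injective (V : Type u) [AddCommGroup V] [Module k V] [Module.Finite k V] :
    Function.Injective (tensorDualToEnd (k := k) V) :=
  (dualTensorHomEquiv k V V).injective.comp (TensorProduct.comm k V (Module.Dual k V)).injective

theorem tensorDualToEnd_coevaluation (V : Type u) [AddCommGroup V] [Module k V]
    [Module.Finite k V] : tensorDualToEnd V (coevaluation k V 1) = 1 := by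
  rw [coevaluation_apply_one]
  ext v
  simp only [map_sum, LinearMap.sum_apply, tensorDualToEnd_tmul, Module.End.one_apply]
  exact (Module.Basis.ofVectorSpace k V).sum_repr v

variable [HopfAlgebra k A]

/-- The dual of a representation with respect to the antipode. -/
def antipodeDualRep {V : Type u} [AddCommGroup V] [Module k V] (ρ : A →ₐ[k] Module.End k V) :
    A →ₐ[k] Module.End k (Module.Dual k V) :=
  dualRep (HopfAlgebra.antipode k) HopfAlgebra.antipode_one
    HopfAlgebra.antipode_mul_antidistrib ρ

/-- The dual module with respect to the antipode. -/
def antipodeDual (V : FinMod k A) : FinMod k A :=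
  dual (HopfAlgebra.antipode k) HopfAlgebra.antipode_one
    HopfAlgebra.antipode_mul_antidistrib V

section Outer

variable {V : Type u} [AddCommGroup V] [Module k V] (ρ : A →ₐ[k] Module.End k V)

theorem tensorDualToEnd_outer (t : A ⊗[k] A) (x : V ⊗[k] Module.Dual k V)
    (hx : tensorDualToEnd V x = 1) :
    tensorDualToEnd V (outer ρ (antipodeDualRep ρ) t x) =
      ρ (LinearMap.mul' k A (LinearMap.lTensor A (HopfAlgebra.antipode k) t)) := by
  induction t with
  | zero => simp
  | add s t hs ht => simp only [map_add, LinearMap.add_apply, hs, ht]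
  | tmul a b =>
    have h : ∀ x : V ⊗[k] Module.Dual k V,
        tensorDualToEnd V (outer ρ (antipodeDualRep ρ) (a ⊗ₜ b) x) =
        ρ a * tensorDualToEnd V x * ρ (HopfAlgebra.antipode k b) := by
      intro x
      induction x with
      | zero => simp
      | add x y hx hy => rw [map_add, map_add, hx, hy, map_add, mul_add, add_mul]
      | tmul v f =>
        ext w
        change f (ρ (HopfAlgebra.antipode k b) w) • ρ a v =
          ρ a (f (ρ (HopfAlgebra.antipode k b) w) • v)
        rw [map_smul]
    rw [h, hx, mul_one, LinearMap.lTensor_tmul, LinearMap.mul'_apply, map_mul]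

theorem contractLeft_outer (t : A ⊗[k] A) (f : Module.Dual k V) (v : V) :
    contractLeft k V (outer (antipodeDualRep ρ) ρ t (f ⊗ₜ v)) =
      f (ρ (LinearMap.mul' k A (LinearMap.rTensor A (HopfAlgebra.antipode k) t)) v) := by
  induction t with
  | zero => simp
  | add s t hs ht => simp only [map_add, LinearMap.add_apply, hs, ht]
  | tmul a b =>
    rw [LinearMap.rTensor_tmul, LinearMap.mul'_apply, map_mul]
    rfl

theorem outer_coevaluation [Module.Finite k V] (a : A) (c : k) :
    coevaluation k V (Coalgebra.counit (R := k) a * c) =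
      outer ρ (antipodeDualRep ρ) (Coalgebra.comul a) (coevaluation k V c) := by
  apply tensorDualToEnd_injective (k := k) V
  have h1 := tensorDualToEnd_outer ρ (Coalgebra.comul a) _ (tensorDualToEnd_coevaluation V)
  rw [HopfAlgebra.mul_antipode_lTensor_comul_apply, AlgHom.commutes] at h1
  have h2 : ∀ c : k, coevaluation k V c = c • coevaluation k V 1 := fun c => by
    rw [← map_smul, smul_eq_mul, mul_one]
  rw [h2 c, h2, map_smul, map_smul, map_smul, h1, tensorDualToEnd_coevaluation, mul_comm,
    mul_smul, Algebra.algebraMap_eq_smul_one]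

theorem contractLeft_outer_comul (a : A) (x : Module.Dual k V ⊗[k] V) :
    contractLeft k V (outer (antipodeDualRep ρ) ρ (Coalgebra.comul a) x) =
      Coalgebra.counit (R := k) a * contractLeft k V x := by
  induction x with
  | zero => simp
  | add x y hx hy => rw [map_add, map_add, hx, hy, map_add, mul_add]
  | tmul f v =>
    rw [contractLeft_outer, HopfAlgebra.mul_antipode_rTensor_comul_apply, AlgHom.commutes,
      contractLeft_apply, Module.algebraMap_end_apply, map_smul, smul_eq_mul]

end Outer

/-- The coevaluation `𝟙 ⟶ V ⊗ V*`. -/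
noncomputable def coev (V : FinMod k A) : unit k A ⟶ act V (antipodeDual V) :=
  ofLin (V := unit k A) (W := act V (antipodeDual V)) (coevaluation k V) (outer_coevaluation V.ρ)

/-- The evaluation `V* ⊗ V ⟶ 𝟙`. -/
noncomputable def ev (V : FinMod k A) : act (antipodeDual V) V ⟶ unit k A :=
  ofLin (V := act (antipodeDual V) V) (W := unit k A) (contractLeft k V)
    (contractLeft_outer_comul V.ρ)

/-- The dual with respect to the antipode is a dual in the monoidal category. -/
@[reducible]
noncomputable def exactPairingAntipodeDual (V : FinMod k A) : ExactPairing V (antipodeDual V) where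
  coevaluation' := coev V
  evaluation' := ev V
  coevaluation_evaluation' := hom_ext (contractLeft_assoc_coevaluation k V)
  evaluation_coevaluation' := hom_ext (contractLeft_assoc_coevaluation' k V)

end Duals

/-! ### Bijectivity of the antipode -/

section Antipode

attribute [local instance] LeftComoduleAlgebra.self

variable {k A : Type u} [Field k] [Ring A] [HopfAlgebra k A]

/-- The map `A ⊗ B → A`, `a ⊗ b ↦ g(b) a`, for a functional `g`. -/
noncomputable def slice {B : Type u} [AddCommGroup B] [Module k B] (g : B →ₗ[k] k) :
    A ⊗[k] B →ₗ[k] A :=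
  (TensorProduct.rid k A).toLinearMap ∘ₗ LinearMap.lTensor A g

@[simp] theorem slice_tmul {B : Type u} [AddCommGroup B] [Module k B] (g : B →ₗ[k] k) (a : A)
    (b : B) : slice g (a ⊗ₜ[k] b) = g b • a := rfl

theorem slice_lTensor {B B' : Type u} [AddCommGroup B] [Module k B] [AddCommGroup B']
    [Module k B'] (g : B' →ₗ[k] k) (φ : B →ₗ[k] B') (x : A ⊗[k] B) :
    slice g (LinearMap.lTensor A φ x) = slice (g ∘ₗ φ) x := by
  rw [slice, slice, LinearMap.lTensor_comp]
  rfl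

theorem eq_zero_of_slice_eq_zero {B : Type u} [AddCommGroup B] [Module k B] (x : A ⊗[k] B)
    (hx : ∀ g : B →ₗ[k] k, slice g x = 0) : x = 0 := by
  classical
  let b := Module.Basis.ofVectorSpace k B
  apply (TensorProduct.equivFinsuppOfBasisRight (M := A) b).injective
  rw [map_zero]
  ext i
  have h : ∀ x : A ⊗[k] B, TensorProduct.equivFinsuppOfBasisRight (M := A) b x i =
      slice (b.coord i) x := by
    intro x
    induction x with
    | zero => simp
    | add x y hx hy => simp only [map_add, Finsupp.add_apply, hx, hy]
    | tmul a c => rw [TensorProduct.equivFinsuppOfBasisRight_apply_tmul_apply]; rfl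
  rw [h, hx, Finsupp.zero_apply]

variable (k A) in
/-- A finite-dimensional Hopf algebra has a nonzero left integral: the coevaluation of the regular
module `A` is an invariant of `A ⊗ A*`, which is a free module. -/
theorem exists_integral [Module.Finite k A] : ∃ Λ : A, Λ ≠ 0 ∧
    ∀ a : A, a * Λ = Coalgebra.counit (R := k) a • Λ := by
  have : Nontrivial A := ⟨⟨1, 0, fun h => one_ne_zero (α := k) (by
    rw [← Bialgebra.counit_one (R := k) (A := A), h, map_zero])⟩⟩
  let e := freeIsoActRegular (isGalois_self k A) (antipodeDual (regular k A))
  let f := coev (regular k A) ≫ e.inv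
  have hf : f ≫ e.hom = coev (regular k A) := by simp [f]
  let φ : k →ₗ[k] A ⊗[k] Module.Dual k A := lin f
  have hx : φ 1 ≠ 0 := by
    intro h0
    have h1 : coevaluation k A 1 = 0 :=
      (LinearMap.congr_fun (congrArg lin hf) (1 : k)).symm.trans
        ((congrArg (lin e.hom) h0).trans (map_zero _))
    have h2 := tensorDualToEnd_coevaluation (k := k) A
    rw [h1, map_zero] at h2
    exact one_ne_zero (LinearMap.congr_fun h2 1).symm
  have hinv : ∀ a : A, LinearMap.rTensor (Module.Dual k A) (LinearMap.mulLeft k a) (φ 1) =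
      Coalgebra.counit (R := k) a • φ 1 := by
    intro a
    have h : φ (Coalgebra.counit (R := k) a * 1) =
      LinearMap.rTensor (Module.Dual k A) (LinearMap.mulLeft k a) (φ 1) := lin_comm f a (1 : k)
    rw [← h, ← map_smul, smul_eq_mul]
  obtain ⟨g, hg⟩ : ∃ g : Module.Dual k A →ₗ[k] k, slice g (φ 1) ≠ 0 := by
    by_contra hc
    push Not at hc
    exact hx (eq_zero_of_slice_eq_zero (φ 1) hc)
  refine ⟨slice g (φ 1), hg, fun a => ?_⟩
  rw [← map_smul, ← hinv]
  generalize φ 1 = y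
  induction y with
  | zero => simp
  | add x y hx hy => simp only [map_add, mul_add, hx, hy]
  | tmul b w => simp

/-- A left integral `Λ` satisfies `aΛ₍₁₎ ⊗ S(Λ₍₂₎) = Λ₍₁₎ ⊗ S(Λ₍₂₎)a`. -/
theorem integral_translation {Λ : A} (hΛ : ∀ a : A, a * Λ = Coalgebra.counit (R := k) a • Λ)
    (a : A) : (a ⊗ₜ[k] (1 : A)) * translation k A Λ = translation k A Λ * ((1 : A) ⊗ₜ[k] a) := by
  let S : A →ₗ[k] A := HopfAlgebra.antipode k
  -- both sides are the image of `a` under `a ↦ a₍₁₎Λ₍₁₎ ⊗ S(a₍₂₎Λ₍₂₎)a₍₃₎`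
  let T : A ⊗[k] A →ₗ[k] A ⊗[k] A :=
    extendRight (LinearMap.lTensor A S ∘ₗ LinearMap.mulRight k (Coalgebra.comul (R := k) Λ) ∘ₗ
      Coalgebra.comul)
  have h1 : T (Coalgebra.comul a) = translation k A Λ * ((1 : A) ⊗ₜ[k] a) := by
    have h : ∀ t : A ⊗[k] A, T t = translation k A Λ * ((1 : A) ⊗ₜ[k]
        TensorProduct.lid k A (LinearMap.rTensor A (Coalgebra.counit (R := k)) t)) := by
      intro t
      induction t with
      | zero => simp
      | add s t hs ht => simp only [map_add, hs, ht, TensorProduct.tmul_add, mul_add]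
      | tmul b c =>
        change LinearMap.lTensor A (LinearMap.mul' k A) (TensorProduct.assoc k A A A
          (LinearMap.lTensor A S (Coalgebra.comul b * Coalgebra.comul Λ) ⊗ₜ c)) = _
        rw [← Bialgebra.comul_mul, hΛ, map_smul, map_smul, LinearMap.rTensor_tmul,
          TensorProduct.lid_tmul, TensorProduct.tmul_smul, mul_smul_comm, ← TensorProduct.smul_tmul',
          map_smul, map_smul]
        congr 1
        change _ = LinearMap.lTensor A S (Coalgebra.comul Λ) * _
        induction LinearMap.lTensor A S (Coalgebra.comul Λ) with
        | zero => simp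
        | add s t hs ht => simp only [map_add, TensorProduct.add_tmul, hs, ht, add_mul]
        | tmul x y => simp
    rw [h, Coalgebra.rTensor_counit_comul, TensorProduct.lid_tmul, one_smul]
  have h2 : T (Coalgebra.comul a) = (a ⊗ₜ[k] (1 : A)) * translation k A Λ := by
    let Q : A ⊗[k] A → A ⊗[k] A →ₗ[k] A ⊗[k] A := fun u => TensorProduct.lift
      (LinearMap.mk₂ k (fun x v => (x ⊗ₜ[k] (1 : A)) * u * ((1 : A) ⊗ₜ[k] v))
        (fun _ _ _ => by rw [TensorProduct.add_tmul, add_mul, add_mul])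
        (fun _ _ _ => by rw [← TensorProduct.smul_tmul', smul_mul_assoc, smul_mul_assoc])
        (fun _ _ _ => by rw [TensorProduct.tmul_add, mul_add])
        (fun _ _ _ => by rw [TensorProduct.tmul_smul, mul_smul_comm]))
    have hQ : ∀ u x v, Q u (x ⊗ₜ v) = (x ⊗ₜ[k] (1 : A)) * u * ((1 : A) ⊗ₜ[k] v) :=
      fun _ _ _ => rfl
    have hu : ∀ (s u : A ⊗[k] A) (c : A),
        LinearMap.lTensor A (LinearMap.mul' k A) (TensorProduct.assoc k A A A
          (LinearMap.lTensor A S (s * u) ⊗ₜ c)) =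
        Q (LinearMap.lTensor A S u) (LinearMap.lTensor A (LinearMap.mul' k A)
          (TensorProduct.assoc k A A A (LinearMap.lTensor A S s ⊗ₜ c))) := by
      intro s u c
      induction s with
      | zero => simp
      | add s t hs ht => simp only [map_add, TensorProduct.add_tmul, add_mul, hs, ht]
      | tmul x y =>
        simp only [LinearMap.lTensor_tmul, TensorProduct.assoc_tmul, LinearMap.mul'_apply, hQ]
        induction u with
        | zero => simp
        | add s t hs ht => simp only [map_add, TensorProduct.add_tmul, mul_add, add_mul, hs, ht]
        | tmul z w => simp [S, HopfAlgebra.antipode_mul_antidistrib, mul_assoc]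
    have h : ∀ t : A ⊗[k] A, T t = Q (translation k A Λ) (extendRight (translation k A) t) := by
      intro t
      induction t with
      | zero => simp
      | add s t hs ht => simp only [map_add, hs, ht]
      | tmul b c => exact hu _ _ _
    rw [h, extendRight_translation, hQ, ← Algebra.TensorProduct.one_def, mul_one]
  rw [← h1, h2]

theorem slice_one_mul {B : Type u} [Ring B] [Algebra k B] (g : B →ₗ[k] k) (b : B)
    (x : A ⊗[k] B) : slice g (x * ((1 : A) ⊗ₜ b)) = slice (g ∘ₗ LinearMap.mulRight k b) x := by
  induction x with
  | zero => simp
  | add x y hx hy => simp only [map_add, add_mul, hx, hy]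
  | tmul a c => simp

theorem slice_mul_one {B : Type u} [Ring B] [Algebra k B] (g : B →ₗ[k] k) (a : A)
    (x : A ⊗[k] B) : slice g ((a ⊗ₜ[k] (1 : B)) * x) = a * slice g x := by
  induction x with
  | zero => simp
  | add x y hx hy => simp only [map_add, mul_add, hx, hy]
  | tmul b c => simp

variable (k A) in
/-- The antipode of a finite-dimensional Hopf algebra is surjective. If a functional `f` vanishes
on its image and `Λ` is a left integral, then `f(S(Λ₍₂₎)a)Λ₍₁₎ = a f(S(Λ₍₂₎))Λ₍₁₎ = 0` for all `a`,
hence `f(c)Λ = f(S(Λ₍₃₎)S(S(Λ₍₂₎))c)Λ₍₁₎ = 0` for all `c`. -/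
theorem antipode_surjective [Module.Finite k A] :
    Function.Surjective (HopfAlgebra.antipode k (A := A)) := by
  rw [← LinearMap.range_eq_top]
  by_contra hne
  obtain ⟨f, hf0, hf⟩ := Submodule.exists_le_ker_of_lt_top _ (lt_top_iff_ne_top.2 hne)
  obtain ⟨Λ, hΛ0, hΛ⟩ := exists_integral k A
  let S : A →ₗ[k] A := HopfAlgebra.antipode k
  have hfS : f ∘ₗ S = 0 := LinearMap.ext fun a => hf ⟨a, rfl⟩
  have h1 : ∀ a, slice ((f ∘ₗ LinearMap.mulRight k a) ∘ₗ S) (Coalgebra.comul (R := k) Λ) = 0 := by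
    intro a
    have h : slice f (translation k A Λ) = 0 := by
      change slice f (LinearMap.lTensor A S (Coalgebra.comul (R := k) Λ)) = 0
      rw [slice_lTensor, hfS, slice, LinearMap.lTensor_zero, LinearMap.comp_zero,
        LinearMap.zero_apply]
    rw [← slice_lTensor, ← slice_one_mul]
    change slice f (translation k A Λ * _) = 0
    rw [← integral_translation hΛ, slice_mul_one, h, mul_zero]
  refine hf0 (LinearMap.ext fun c => ?_)
  let G : A ⊗[k] A →ₗ[k] k :=
    f ∘ₗ LinearMap.mulRight k c ∘ₗ S ∘ₗ LinearMap.mul' k A ∘ₗ LinearMap.rTensor A S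
  have h2 : slice G (TensorProduct.assoc k A A A (LinearMap.rTensor A (Coalgebra.comul (R := k))
      (Coalgebra.comul (R := k) Λ))) = f c • Λ := by
    have hG : G ∘ₗ Coalgebra.comul = f c • Coalgebra.counit := by
      ext a
      change f (S (LinearMap.mul' k A (LinearMap.rTensor A (HopfAlgebra.antipode k)
        (Coalgebra.comul a))) * c) = _
      rw [HopfAlgebra.mul_antipode_rTensor_comul_apply, Algebra.algebraMap_eq_smul_one, map_smul,
        show S 1 = 1 from HopfAlgebra.antipode_one, smul_mul_assoc, one_mul, map_smul, smul_eq_mul,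
        LinearMap.smul_apply, smul_eq_mul, mul_comm]
    rw [Coalgebra.coassoc_apply, slice_lTensor, hG, slice, LinearMap.lTensor_smul,
      LinearMap.comp_apply, LinearMap.smul_apply, Coalgebra.lTensor_counit_comul]
    simp
  have h3 : ∀ u : A ⊗[k] A, slice G (TensorProduct.assoc k A A A
      (LinearMap.rTensor A (Coalgebra.comul (R := k)) u)) =
      ∑ j, slice ((Module.finBasis k A).coord j ∘ₗ LinearMap.mulRight k c ∘ₗ S ∘ₗ S)
        (Coalgebra.comul (R := k)
          (slice ((f ∘ₗ LinearMap.mulRight k (Module.finBasis k A j)) ∘ₗ S) u)) := by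
    intro u
    induction u with
    | zero => simp
    | add x y hx hy => simp only [map_add, hx, hy, Finset.sum_add_distrib]
    | tmul p z =>
      simp only [LinearMap.rTensor_tmul, slice_tmul, map_smul]
      induction Coalgebra.comul (R := k) p with
      | zero => simp
      | add x y hx hy =>
        simp only [map_add, TensorProduct.add_tmul, hx, hy, smul_add, Finset.sum_add_distrib]
      | tmul x y =>
        have hS : S (S y * z) = S z * S (S y) := HopfAlgebra.antipode_mul_antidistrib _ _
        simp only [TensorProduct.assoc_tmul, slice_tmul, smul_smul, ← Finset.sum_smul]
        congr 1
        simp only [G, LinearMap.comp_apply, LinearMap.rTensor_tmul, LinearMap.mul'_apply,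
          LinearMap.mulRight_apply, hS, mul_assoc]
        have hb := congrArg (f ∘ₗ LinearMap.mulLeft k (S z))
          ((Module.finBasis k A).sum_repr (S (S y) * c))
        rw [map_sum] at hb
        refine hb.symm.trans (Finset.sum_congr rfl fun j _ => ?_)
        rw [map_smul, smul_eq_mul, mul_comm]
        rfl
  rw [h3] at h2
  simp only [h1, map_zero, Finset.sum_const_zero] at h2
  exact (smul_eq_zero.1 h2.symm).resolve_right hΛ0

end Antipode

/-! ### The tensor category of a finite-dimensional Hopf algebra -/

section TensorCategory

variable {k A : Type u} [Field k] [Ring A]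

theorem monoidalPreadditive [Bialgebra k A] : MonoidalPreadditive (FinMod k A) where
  whiskerLeft_zero := hom_ext (TensorProduct.map_zero_right LinearMap.id)
  zero_whiskerRight := hom_ext (TensorProduct.map_zero_left LinearMap.id)
  whiskerLeft_add f g := hom_ext (TensorProduct.map_add_right LinearMap.id (lin f) (lin g))
  add_whiskerRight f g := hom_ext (TensorProduct.map_add_left (lin f) (lin g) LinearMap.id)

theorem monoidalLinear [Bialgebra k A] :
    have := monoidalPreadditive (k := k) (A := A)
    MonoidalLinear k (FinMod k A) :=
  have := monoidalPreadditive (k := k) (A := A)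
  { whiskerLeft_smul := fun _ _ _ r f =>
      hom_ext (TensorProduct.map_smul_right r LinearMap.id (lin f))
    smul_whiskerRight := fun r _ _ f _ =>
      hom_ext (TensorProduct.map_smul_left r (lin f) LinearMap.id) }

variable (k A) in
theorem simple_unit [Bialgebra k A] : Simple (unit k A) := by
  refine (simple_iff _).2 ⟨inferInstanceAs (Nontrivial k), fun p _ => ?_⟩
  exact eq_bot_or_eq_top (α := Submodule k k) p

variable [HopfAlgebra k A] [Module.Finite k A]

variable (k A) in
/-- The antipode of a finite-dimensional Hopf algebra as a linear equivalence. -/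
noncomputable def antipodeEquiv : A ≃ₗ[k] A :=
  LinearEquiv.ofBijective (HopfAlgebra.antipode k)
    ⟨LinearMap.injective_iff_surjective.2 (antipode_surjective k A), antipode_surjective k A⟩

theorem antipodeEquiv_symm_one : (antipodeEquiv k A).symm 1 = 1 :=
  (LinearEquiv.symm_apply_eq _).2 HopfAlgebra.antipode_one.symm

theorem antipodeEquiv_symm_mul (a b : A) : (antipodeEquiv k A).symm (a * b) =
    (antipodeEquiv k A).symm b * (antipodeEquiv k A).symm a := by
  refine (LinearEquiv.symm_apply_eq _).2 (Eq.symm ?_)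
  refine (HopfAlgebra.antipode_mul_antidistrib (R := k) _ _).trans ?_
  exact congrArg₂ (· * ·) ((antipodeEquiv k A).apply_symm_apply a)
    ((antipodeEquiv k A).apply_symm_apply b)

/-- The dual module with respect to the inverse of the antipode. -/
noncomputable def antipodeSymmDual (V : FinMod k A) : FinMod k A :=
  dual (antipodeEquiv k A).symm.toLinearMap antipodeEquiv_symm_one antipodeEquiv_symm_mul V

/-- A module is the dual with respect to the antipode of its dual with respect to the inverse of
the antipode. -/
noncomputable def doubleDualIso (V : FinMod k A) : V ≅ antipodeDual (antipodeSymmDual V) :=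
  isoOfLin (V := V) (W := antipodeDual (antipodeSymmDual V)) (Module.evalEquiv k V) fun a v => by
    refine LinearMap.ext fun f : Module.Dual k V => ?_
    change f (V.ρ a v) = f (V.ρ ((antipodeEquiv k A).symm (antipodeEquiv k A a)) v)
    rw [LinearEquiv.symm_apply_apply]

variable (k A) in
/-- The category of finite-dimensional modules over a finite-dimensional Hopf algebra is rigid. -/
@[reducible]
noncomputable def rigidCategory : RigidCategory (FinMod k A) where
  rightDual V := { rightDual := antipodeDual V, exact := exactPairingAntipodeDual V }
  leftDual V :=
    { leftDual := antipodeSymmDual V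
      exact :=
        letI := exactPairingAntipodeDual (antipodeSymmDual V)
        exactPairingCongrRight (doubleDualIso V) }

variable (k A) in
/-- The finite-dimensional modules over a finite-dimensional Hopf algebra form a finite tensor
category. -/
theorem isFiniteTensorCategory : IsFiniteTensorCategory k (FinMod k A) where
  finiteAbelian := isFiniteAbelian
  monoidalPreadditive := monoidalPreadditive
  monoidalLinear := monoidalLinear
  rigid := ⟨rigidCategory k A⟩
  simple_unit := simple_unit k A

end TensorCategory

theorem isUnitalZPlusRing {k A : Type u} [Field k] [Ring A] [Bialgebra k A] [Module.Finite k A] :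
    IsUnitalZPlusRing (Gr.irrBasis (k := k) (A := A)) where
  mul_nonneg i j l := by
    rw [Gr.irrBasis_apply, Gr.irrBasis_apply, Gr.irr_eq_cls_rep, Gr.irr_eq_cls_rep]
    have e : Gr.cls (rep i) * Gr.cls (rep j) = Gr.cls (tensor (rep i) (rep j)) := Gr.mulHom_cls _ _
    rw [e]
    exact Gr.repr_cls_nonneg _ _
  one_mem := ⟨Quotient.mk _ ⟨unit k A, simple_unit k A⟩, Gr.irrBasis_apply _⟩

end FinMod

/-! ### Algebras that are finite over a central subalgebra -/

/-- The Nullstellensatz: a maximal ideal of a finitely generated commutative algebra has residue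
field `k`. -/
theorem exists_sub_algebraMap_mem {k R : Type*} [Field k] [CommRing R] [Algebra k R]
    [IsAlgClosed k] [Algebra.FiniteType k R] (𝔪 : Ideal R) [h𝔪 : 𝔪.IsMaximal] (c : R) :
    ∃ r : k, c - algebraMap k R r ∈ 𝔪 := by
  let := Ideal.Quotient.field 𝔪
  have : Module.Finite k (R ⧸ 𝔪) := finite_of_finite_type_of_isJacobsonRing k (R ⧸ 𝔪)
  obtain ⟨r, hr⟩ := (IsAlgClosed.algebraMap_bijective_of_isIntegral (k := k) (K := R ⧸ 𝔪)).2
    (Ideal.Quotient.mk 𝔪 c)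
  exact ⟨r, Ideal.Quotient.eq.1 hr.symm⟩

section CentralSubalgebra

variable {k R M : Type*} [Field k] [CommRing R] [Algebra k R] [Ring M] [Algebra k M] [Algebra R M]
  [IsScalarTower k R M]

/-- The Artin–Tate lemma, with a noncommutative top ring. -/
theorem finiteType_of_finite_of_injective [Algebra.FiniteType k M] [Module.Finite R M]
    (hinj : Function.Injective (algebraMap R M)) : Algebra.FiniteType k R := by
  obtain ⟨B, hB, hfin⟩ := exists_subalgebra_of_fg k R M (Algebra.FiniteType.out (R := k))
    (Module.Finite.fg_top (R := R))
  have : Algebra.FiniteType k B := B.fg_iff_finiteType.1 hB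
  have : IsNoetherianRing B := Algebra.FiniteType.isNoetherianRing k B
  have : Module.Finite B M := ⟨hfin⟩
  have : IsNoetherian B M := isNoetherian_of_isNoetherianRing_of_finite B M
  let i : R →ₗ[B] M := (Algebra.linearMap R M).restrictScalars B
  have : Module.Finite B R := Module.Finite.of_injective i hinj
  exact Algebra.FiniteType.trans (S := B) inferInstance inferInstance

/-- Nakayama's lemma for a finite, faithful, possibly noncommutative algebra. -/
theorem map_algebraMap_ne_top [Module.Finite R M] (hinj : Function.Injective (algebraMap R M))
    (I : Ideal R) (hI : I ≠ ⊤) : Ideal.map (algebraMap R M) I ≠ ⊤ := by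
  intro htop
  have hle : ∀ x ∈ Ideal.map (algebraMap R M) I, x ∈ I • (⊤ : Submodule R M) := by
    intro x hx
    induction hx using Submodule.span_induction with
    | zero => exact Submodule.zero_mem _
    | add x y _ _ hx hy => exact Submodule.add_mem _ hx hy
    | smul a x _ hx =>
      have : ∀ y ∈ I • (⊤ : Submodule R M), a * y ∈ I • (⊤ : Submodule R M) := by
        intro y hy
        refine Submodule.smul_induction_on hy (fun r hr m _ => ?_) fun x y hx hy => ?_
        · rw [mul_smul_comm]
          exact Submodule.smul_mem_smul hr trivial
        · rw [mul_add]
          exact Submodule.add_mem _ hx hy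
      exact this x hx
    | mem x hx =>
      obtain ⟨c, hc, rfl⟩ := hx
      have := Submodule.smul_mem_smul hc (Submodule.mem_top (R := R) (x := (1 : M)))
      rwa [← Algebra.algebraMap_eq_smul_one] at this
  obtain ⟨r, hr, h⟩ := Submodule.exists_sub_one_mem_and_smul_eq_zero_of_fg_of_le_smul I
    (⊤ : Submodule R M) Module.Finite.fg_top fun x _ => hle x (htop ▸ trivial)
  have h1 := h 1 trivial
  rw [Algebra.smul_def, mul_one] at h1
  have h0 : r = 0 := hinj (h1.trans (map_zero _).symm)
  rw [h0, zero_sub, neg_mem_iff] at hr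
  exact hI ((Ideal.eq_top_iff_one I).2 hr)

end CentralSubalgebra

/-! ### The fiber algebras -/

namespace FinMod

open LeftComoduleAlgebra

section FiberAlgebra

variable {k H : Type u} [Field k] [Ring H] [HopfAlgebra k H] (C : Subalgebra k H)

/-- The ring structure of `C`, recorded as commutative. -/
abbrev commRingFinHopf [FinHopf C] : CommRing C :=
  { (inferInstance : Ring C) with
    mul_comm := fun a b =>
      Subtype.ext (Subalgebra.mem_center_iff.1 (FinHopf.central b.2) a) }

/-- `H` as an algebra over the central subalgebra `C`. -/
abbrev algebraFinHopf [FinHopf C] :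
    letI := commRingFinHopf C
    Algebra C H :=
  letI := commRingFinHopf C
  { (inferInstance : Module C H) with
    algebraMap := C.val.toRingHom
    commutes' := fun c x => (Subalgebra.mem_center_iff.1 (FinHopf.central c.2) x).symm
    smul_def' := fun _ _ => rfl }

theorem exists_sub_algebraMap_mem_of_finHopf [IsAlgClosed k] [FinHopf C] (𝔪 : Ideal C)
    (h𝔪 : 𝔪.IsMaximal) (c : C) : ∃ r : k, c - algebraMap k C r ∈ 𝔪 := by
  let := commRingFinHopf C
  let := algebraFinHopf C
  have := FinHopf.affine C
  have : Module.Finite C H := FinHopf.finite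
  have : Algebra.FiniteType k C :=
    finiteType_of_finite_of_injective (M := H) Subtype.val_injective
  exact exists_sub_algebraMap_mem (k := k) 𝔪 (h𝔪 := h𝔪) c

/-- `C` acts by scalars on its fiber at a maximal ideal. -/
theorem exists_scalar [IsAlgClosed k] [FinHopf C] (𝔪 : Ideal C) (h𝔪 : 𝔪.IsMaximal) (c : C) :
    ∃ r : k, Ideal.Quotient.mkₐ k (fiberIdeal C 𝔪) (c : H) = algebraMap k _ r := by
  obtain ⟨r, hr⟩ := exists_sub_algebraMap_mem_of_finHopf C 𝔪 h𝔪 c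
  have h2 := mk_eq_zero_of_mem C hr
  rw [AddSubgroupClass.coe_sub, map_sub, sub_eq_zero] at h2
  exact ⟨r, h2⟩

theorem nontrivial_fiber [FinHopf C] (𝔪 : Ideal C) (h𝔪 : 𝔪.IsMaximal) :
    Nontrivial (Fiber C 𝔪) := by
  refine Ideal.Quotient.nontrivial_iff.2 ?_
  let := commRingFinHopf C
  let := algebraFinHopf C
  have : Module.Finite C H := FinHopf.finite
  exact map_algebraMap_ne_top (M := H) Subtype.val_injective 𝔪 h𝔪.ne_top

/-- Generators of `H` as a `C`-module span a fiber on which `C` acts by scalars. -/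
theorem finite_fiber [FinHopf C] (𝔪 : Ideal C)
    (hs : ∀ c : C, ∃ r : k, Ideal.Quotient.mkₐ k (fiberIdeal C 𝔪) (c : H) = algebraMap k _ r) :
    Module.Finite k (Fiber C 𝔪) := by
  obtain ⟨s, hspan⟩ := (FinHopf.finite (C := C)).fg_top
  refine ⟨?_⟩
  refine (Submodule.fg_def).2 ⟨Ideal.Quotient.mkₐ k (fiberIdeal C 𝔪) '' s,
    s.finite_toSet.image _, (Submodule.eq_top_iff'.2 fun x => ?_)⟩
  obtain ⟨h, rfl⟩ := Ideal.Quotient.mk_surjective x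
  have hh : h ∈ Submodule.span C (s : Set H) := hspan ▸ trivial
  induction hh using Submodule.span_induction with
  | zero => rw [map_zero]; exact Submodule.zero_mem _
  | add x y _ _ hx hy => rw [map_add]; exact Submodule.add_mem _ hx hy
  | mem x hx => exact Submodule.subset_span ⟨x, hx, rfl⟩
  | smul c x _ hx =>
    obtain ⟨r, hr⟩ := hs c
    have : Ideal.Quotient.mkₐ k (fiberIdeal C 𝔪) (c • x) =
        r • Ideal.Quotient.mkₐ k (fiberIdeal C 𝔪) x := by
      rw [Algebra.smul_def, ← hr, ← map_mul]
      rfl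
    exact this.symm ▸ Submodule.smul_mem _ r hx

section Galois

variable [FinHopf C] (𝔪 : Ideal C)

/-- The map `H → H/𝔪H ⊗ H/𝔪H`, `h ↦ ∑ h₍₁₎ ⊗ S(h₍₂₎)`. -/
noncomputable def preTranslation : H →ₗ[k] Fiber C 𝔪 ⊗[k] Fiber C 𝔪 :=
  TensorProduct.map (Ideal.Quotient.mkₐ k (fiberIdeal C 𝔪)).toLinearMap
    (Ideal.Quotient.mkₐ k (fiberIdeal C 𝔪)).toLinearMap ∘ₗ translation k H

/-- As `C` acts on the fiber by scalars, the factors `c₍₁₎` and `S(c₍₂₎)` can be collected in one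
tensor factor, where they multiply to the counit. -/
theorem preTranslation_mul_coe
    (hs : ∀ c : C, ∃ r : k, Ideal.Quotient.mkₐ k (fiberIdeal C 𝔪) (c : H) = algebraMap k _ r)
    (h : H) (c : C) :
    preTranslation C 𝔪 (h * c) = Coalgebra.counit (R := k) (c : H) • preTranslation C 𝔪 h := by
  let q := Ideal.Quotient.mkₐ k (fiberIdeal C 𝔪)
  let S := HopfAlgebra.antipode k (A := H)
  let i := C.val.toLinearMap
  have key : ∀ (s : H ⊗[k] H) (t : C ⊗[k] C),
      TensorProduct.map q.toLinearMap q.toLinearMap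
        (LinearMap.lTensor H S (s * TensorProduct.map i i t)) =
      TensorProduct.map q.toLinearMap q.toLinearMap (LinearMap.lTensor H S s) *
        (1 ⊗ₜ q (LinearMap.mul' k H (LinearMap.lTensor H S (TensorProduct.map i i t)))) := by
    intro s t
    induction s with
    | zero => simp
    | add s s' hs hs' => simp only [map_add, add_mul, hs, hs']
    | tmul x y =>
      induction t with
      | zero => simp
      | add t t' ht ht' => simp only [map_add, mul_add, TensorProduct.tmul_add, ht, ht']
      | tmul c d =>
        obtain ⟨r, hr⟩ := hs c
        obtain ⟨r', hr'⟩ := hs ⟨_, FinHopf.antipode_mem (d : H) d.2⟩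
        replace hr : q (c : H) = r • 1 := hr.trans (Algebra.algebraMap_eq_smul_one r)
        replace hr' : q (S (d : H)) = r' • 1 := hr'.trans (Algebra.algebraMap_eq_smul_one r')
        rw [TensorProduct.map_tmul i i, Algebra.TensorProduct.tmul_mul_tmul]
        change q (x * c) ⊗ₜ[k] q (S (y * d)) = (q x ⊗ₜ q (S y)) * (1 ⊗ₜ q (c * S d))
        rw [HopfAlgebra.antipode_mul_antidistrib, map_mul, map_mul, map_mul, hr, hr',
          Algebra.TensorProduct.tmul_mul_tmul]
        simp only [mul_smul_comm, smul_mul_assoc, mul_one, one_mul, TensorProduct.smul_tmul',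
          TensorProduct.tmul_smul, smul_smul]
        rfl
  obtain ⟨t, ht⟩ := FinHopf.comul_mem (c : H) c.2
  have h1 := key (Coalgebra.comul (R := k) h) t
  rw [ht, HopfAlgebra.mul_antipode_lTensor_comul_apply, Algebra.algebraMap_eq_smul_one, map_smul,
    map_one, TensorProduct.tmul_smul, mul_smul_comm, ← Algebra.TensorProduct.one_def, mul_one,
    ← Bialgebra.comul_mul] at h1
  exact h1

theorem preTranslation_eq_zero
    (hs : ∀ c : C, ∃ r : k, Ideal.Quotient.mkₐ k (fiberIdeal C 𝔪) (c : H) = algebraMap k _ r)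
    (x : H) (hx : x ∈ fiberIdeal C (augIdeal C)) :
    preTranslation C 𝔪 x = 0 := by
  suffices ∀ a : H, preTranslation C 𝔪 (a * x) = 0 by simpa using this 1
  induction hx using Submodule.span_induction with
  | zero => simp
  | add x y _ _ hx hy => intro a; rw [mul_add, map_add, hx, hy, add_zero]
  | smul r x _ hx => intro a; rw [smul_eq_mul, ← mul_assoc, hx]
  | mem x hx =>
    obtain ⟨c, hc, rfl⟩ := hx
    intro a
    replace hc : Coalgebra.counit (R := k) (c : H) = 0 := hc
    refine (preTranslation_mul_coe C 𝔪 hs a c).trans ?_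
    rw [hc, zero_smul]

/-- The translation map of `H` descends to the fibers on which `C` acts by scalars. -/
theorem isGalois_fiber
    (hs : ∀ c : C, ∃ r : k, Ideal.Quotient.mkₐ k (fiberIdeal C 𝔪) (c : H) = algebraMap k _ r) :
    IsGalois k (Fiber C (augIdeal C)) (Fiber C 𝔪) := by
  let p := Ideal.Quotient.mkₐ k (fiberIdeal C (augIdeal C))
  let q := Ideal.Quotient.mkₐ k (fiberIdeal C 𝔪)
  let τ : Fiber C (augIdeal C) →ₗ[k] Fiber C 𝔪 ⊗[k] Fiber C 𝔪 :=
    Submodule.liftQ ((fiberIdeal C (augIdeal C)).restrictScalars k) (preTranslation C 𝔪)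
      fun x hx => preTranslation_eq_zero C 𝔪 hs x hx
  have hτ : ∀ h : H, τ (p h) = TensorProduct.map q.toLinearMap q.toLinearMap (translation k H h) :=
    fun h => rfl
  have hδ : ∀ h : H, (coact (k := k) (A := Fiber C (augIdeal C)) (D := Fiber C 𝔪)).toLinearMap
      (q h) = TensorProduct.map p.toLinearMap q.toLinearMap (Coalgebra.comul (R := k) h) :=
    fun h => rfl
  refine ⟨τ, fun d => ?_, fun a => ?_⟩
  · obtain ⟨h, rfl⟩ := Ideal.Quotient.mk_surjective d
    refine (congrArg (extendRight τ) (hδ h)).trans ?_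
    refine (extendRight_naturality (translation k H) τ p.toLinearMap q.toLinearMap q hτ _).trans ?_
    rw [extendRight_translation]
    exact congrArg (q h ⊗ₜ[k] ·) (map_one q)
  · obtain ⟨h, rfl⟩ := Ideal.Quotient.mk_surjective a
    refine (congrArg _ (hτ h)).trans ?_
    refine (extendRight_naturality (Coalgebra.comul (R := k)) _ q.toLinearMap p.toLinearMap q hδ
      _).trans ?_
    rw [extendRight_comul]
    exact congrArg (p h ⊗ₜ[k] ·) (map_one q)

end Galois

end FiberAlgebra

end FinMod

theorem mainTheorem6 {k H : Type u} [Field k] [IsAlgClosed k] [Ring H] [HopfAlgebra k H]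
    (C : Subalgebra k H) [FinHopf C] (𝔪 : Ideal C) (h𝔪 : 𝔪.IsMaximal) :
    IsFiniteTensorCategory k (FinMod k (Fiber C (augIdeal C))) ∧
    IsModuleCategory k (FinMod k (Fiber C (augIdeal C))) (FinMod k (Fiber C 𝔪)) ∧
    IsFiniteAbelian k (FinMod k (Fiber C 𝔪)) ∧
    IsIndecomposableModuleCategory.{u, u, u + 1, u, u + 1, v₂, u₂} k
      (FinMod k (Fiber C (augIdeal C))) (FinMod k (Fiber C 𝔪)) ∧
    IsExactModuleCategory (FinMod k (Fiber C (augIdeal C))) (FinMod k (Fiber C 𝔪)) ∧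
    ∃ (b : Module.Basis (Irr (FinMod k (Fiber C (augIdeal C)))) ℤ (Gr k (Fiber C (augIdeal C))))
      (m : Module.Basis (Irr (FinMod k (Fiber C 𝔪))) ℤ (Gr k (Fiber C 𝔪))),
      (∀ S, b S = Gr.irr S) ∧ (∀ S, m S = Gr.irr S) ∧
      IsUnitalZPlusRing b ∧ IsIrreducibleZPlusModule b m := by
  have := FinMod.finite_fiber C (augIdeal C) fun c => ⟨_, mk_augIdeal C c⟩
  have hs := FinMod.exists_scalar C 𝔪 h𝔪
  have := FinMod.finite_fiber C 𝔪 hs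
  have := FinMod.nontrivial_fiber C 𝔪 h𝔪
  have hG := FinMod.isGalois_fiber C 𝔪 hs
  exact ⟨FinMod.isFiniteTensorCategory k _, FinMod.isModuleCategory, FinMod.isFiniteAbelian,
    FinMod.isIndecomposableModuleCategory hG, FinMod.isExactModuleCategory hG, Gr.irrBasis, Gr.irrBasis,
    Gr.irrBasis_apply, Gr.irrBasis_apply, FinMod.isUnitalZPlusRing, FinMod.isIrreducibleZPlusModule hG⟩
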